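/- Let $(T,\mathcal A,\mu)$ be a complete finite measure space and let $X$ be a separable Asplund (Banach) space whose norm is $C^1$ away from the origin, with dual $X^*$. A function $f:T\times X\to\overline{\mathbb R}$ is a normal integrand if it is $\mathcal A\otimes\mathcal B(X)$-measurable and $f_t:=f(t,\cdot)$ is lower semicontinuous for every $t\in T$. Put $I_f(x):=\int_T f(t,x)\,d\mu(t)=\int_T f(t,x)^+d\mu(t)-\int_T f(t,x)^-d\mu(t)$, with the convention $\infty+(-\infty)=+\infty$. For $\varphi:X\to\overline{\mathbb R}$ finite at $x$, the Fréchet subdifferential $\hat\partial\varphi(x)$ is the set of all $x^*\in X^*$ with $$\liminf_{h\to0}\frac{\varphi(x+h)-\varphi(x)-\langle x^*,h\rangle}{\|h\|}\ge 0,$$ and $\hat\partial\varphi(x):=\emptyset$ if $\varphi(x)$ is not finite; write $\hat\partial f(t,x):=\hat\partial f_t(x)$. Let $p,q\in(1,+\infty)$ with $1/p+1/q=1$. Let $f$ and $g$ be normal integrands, $g$ real-valued, such that $f(t,x)\ge g(t,x)$ for all $t\in T$, $x\in X$, and $g_t$ is of class $C^1$ for every $t\in T$. Assume that $g(\cdot,u)$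 is $\mu$-integrable for some $u\in X$ and that the function $\sup_{u\in X}\|\nabla g(\cdot,u)\|$ belongs to $L^q(T,\mathbb R)$. Then for every $x\in X$, every $x^*\in\hat\partial I_f(x)$ and every $w^*$-continuous seminorm $\rho$ on $X^*$ there exist sequences $y_n\in X$, $x_n\in L^p(T,X)$ and $x_n^*\in L^q(T,X^*)$ such that (a) $x_n^*(t)\in\hat\partial f(t,x_n(t))$ for almost every $t\in T$, for every $n$; (b) $\|x-y_n\|\to0$ and $\|x-x_n(\cdot)\|_p\to0$; (c) $\|x_n^*(\cdot)\|_q\,\|x_n(\cdot)-y_n\|_p\to0$; (d) $\int_T\langle x_n^*(t),x_n(t)-x\rangle\,d\mu(t)\to0$; (e) $\rho\left(\int_T x_n^*(t)\,d\mu(t)-x^*\right)\to0$, the integral being a Bochner integral; (f) $\int_T|f(t,x_n(t))-f(t,x)|\,d\mu(t)\to0$. -/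

import Mathlib

open MeasureTheory Filter Topology Set

/-- `X` is an Asplund space: every continuous convex function on an open convex set `U` is
Fréchet differentiable at every point of a dense `G_δ` subset of `U`. -/
def IsAsplund (X : Type*) [NormedAddCommGroup X] [NormedSpace ℝ X] : Prop :=
  ∀ (U : Set X) (φ : X → ℝ), IsOpen U → ConvexOn ℝ U φ → ContinuousOn φ U →
    ∃ G ⊆ U, IsGδ G ∧ U ⊆ closure G ∧ ∀ x ∈ G, DifferentiableAt ℝ φ x

/-- Normal integrand: jointly measurable for the product of the given `σ`-algebra on `T` and the
(Borel) `σ`-algebra on `X`, and lower semicontinuous in the second variable. -/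
def IsNormalIntegrand {T X : Type*} [MeasurableSpace T] [TopologicalSpace X] [MeasurableSpace X]
    (f : T → X → EReal) : Prop :=
  Measurable (Function.uncurry f) ∧ ∀ t, LowerSemicontinuous (f t)

/-- The integral `∫ φ⁺ dμ - ∫ φ⁻ dμ` of an extended-real-valued function, with the convention
`∞ + (-∞) = +∞`. -/
noncomputable def extIntegral {T : Type*} [MeasurableSpace T] (μ : Measure T) (φ : T → EReal) :
    EReal :=
  open Classical in
  if ∫⁻ t, (φ t).toENNReal ∂μ = ⊤ then ⊤
  else ((∫⁻ t, (φ t).toENNReal ∂μ : ENNReal) : EReal)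
    - ((∫⁻ t, (-(φ t)).toENNReal ∂μ : ENNReal) : EReal)

/-- The integral functional `I_f(x) = ∫ f(t, x) dμ(t)` on `X`. -/
noncomputable def integralFunctional {T X : Type*} [MeasurableSpace T] (μ : Measure T)
    (f : T → X → EReal) (x : X) : EReal :=
  extIntegral μ fun t => f t x

/-- The Fréchet (regular) subdifferential of `φ` at `x`; it is empty if `φ x` is not finite. -/
noncomputable def frechetSubdiff {X : Type*} [NormedAddCommGroup X] [NormedSpace ℝ X]
    (φ : X → EReal) (x : X) : Set (StrongDual ℝ X) :=
  {x' | φ x ≠ ⊥ ∧ φ x ≠ ⊤ ∧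
    0 ≤ liminf (fun h : X => (φ (x + h) - φ x - ((x' h : ℝ) : EReal)) / ((‖h‖ : ℝ) : EReal))
      (𝓝[≠] (0 : X))}

/-! Translate so that the base point is `0`, and write `κ = ∫ k`, with `k` an `L^q` Lipschitz
modulus of `g`. Young's inequality makes `f(t, x+v) + ‖v-y‖^p + k(t)‖y‖ + c(t)` nonnegative for a
suitable integrable `c`; call this `h(t,v,y)`. All functionals then take values in `[0,∞]`, and on
the diagonal `v = y` the integral of `h` is `I_f(x+y) + κ‖y‖` up to a constant. That `x'` is a
Fréchet subgradient says that the diagonal functional plus `θ(y) = C - κ‖y‖ - x' y + η‖y‖` has a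
minimum at `0` with linear growth on a small ball. The variables are decoupled: `v` ranges over
`L^p`, `y` over a small ball `K` of a finite-dimensional space `L`, and `n‖v-y‖^p` is added.
Minimizing over the compact `K` leaves a lower semicontinuous functional of `v`, to which the
Borwein-Preiss principle applies with perturbation `∑ δ_i ‖v-z_i‖_p^p`
(`LowerSemicontinuous.exists_forall_add_tsum_edist_rpow_le`, `exists_perturbed_minimizer`). As `n`
grows, growth at `0` forces `y → 0`, `(n+1)‖v-y‖_p^p → 0` and `L^1` convergence of `h` along a
subsequence (`exists_subseq_tendsto_of_penalized_le`). For fixed `y`, measurable selection turns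
minimality in `L^p` into pointwise minimality (`ae_forall_le_of_forall_lintegral_le`). Since the
norm is smooth, Fermat's rule gives `w(t) ∈ ∂̂f(t, x+v(t))`, where `-w` is the derivative of the
penalty and perturbation terms (`ae_mem_frechetSubdiff_of_minimizer`). Stationarity in `y` says that
the penalty part of `∫ w` is `η`-close to `x'` on `L` (`abs_apply_integral_fderiv_add_le`), and the
perturbation part is small in `L^q`. The product bound (c) holds because `‖w‖_q` is of order
`(n+1)‖v-y‖_p^(p-1)` up to a small term. Finally a `w*`-continuous seminorm only sees finitely many
vectors, whose span is taken as `L`. -/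

/-! ### Measurable selection over a set of positive measure -/

section Selection

variable {T X : Type*} [MeasurableSpace T]

/-- A measurable subset of `T × X` is the preimage of a Borel subset of `2^ℕ × X` under a
measurable map acting on the first coordinate. -/
theorem MeasurableSet.exists_eq_preimage_prodMap_cantor [MeasurableSpace X] {B : Set (T × X)}
    (hB : MeasurableSet B) :
    ∃ (c : T → ℕ → Bool) (B' : Set ((ℕ → Bool) × X)), Measurable c ∧ MeasurableSet B' ∧
      B = Prod.map c id ⁻¹' B' := by
  classical
  rw [← generateFrom_prod] at hB
  induction B, hB using MeasurableSpace.generateFrom_induction with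
  | hC s hs _ =>
    obtain ⟨A, hA, D, hD, rfl⟩ := hs
    refine ⟨fun t _ => decide (t ∈ A), {z | z.1 0 = true} ∩ Prod.snd ⁻¹' D, ?_, ?_, ?_⟩
    · refine measurable_pi_lambda _ fun _ => ?_
      exact measurable_to_bool (by simpa [preimage, mem_singleton_iff] using hA)
    · refine MeasurableSet.inter ?_ (measurable_snd hD)
      exact measurableSet_eq_fun ((measurable_pi_apply 0).comp measurable_fst) measurable_const
    · ext ⟨t, u⟩
      simp
  | empty => exact ⟨fun _ _ => true, ∅, measurable_const, .empty, by simp⟩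
  | compl s _ ih =>
    obtain ⟨c, B', hc, hB', rfl⟩ := ih
    exact ⟨c, B'ᶜ, hc, hB'.compl, by simp⟩
  | iUnion s _ ih =>
    choose c B' hc hB' hs using ih
    -- Countably many codes are interleaved into one by the pairing of `ℕ`; block `i` recovers the
    -- `i`-th code.
    refine ⟨fun t n => c n.unpair.1 t n.unpair.2,
      ⋃ i, (fun z : (ℕ → Bool) × X => ((fun n => z.1 (Nat.pair i n)), z.2)) ⁻¹' B' i, ?_, ?_, ?_⟩
    · refine measurable_pi_lambda _ fun n => ?_
      exact (measurable_pi_apply _).comp (hc _)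
    · refine MeasurableSet.iUnion fun i => ?_
      refine Measurable.prodMk ?_ measurable_snd (hB' i)
      exact measurable_pi_lambda _ fun n => (measurable_pi_apply _).comp measurable_fst
    · ext ⟨t, u⟩
      simp [hs]

/-- A continuous map has a Borel right inverse on the image of a compact set, provided its domain
carries a continuous injection to the line. -/
theorem IsCompact.exists_measurable_rightInverse {Y Z : Type*} [TopologicalSpace Y]
    [MeasurableSpace Y] [BorelSpace Y] [Nonempty Y] [TopologicalSpace Z] [T2Space Z]
    [MeasurableSpace Z] [BorelSpace Z] {K : Set Y} (hK : IsCompact K) {φ : Y → Z}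
    (hφ : Continuous φ) {e : Y → ℝ} (he : Continuous e) (hinj : Function.Injective e) :
    ∃ s : Z → Y, Measurable s ∧ ∀ z ∈ φ '' K, s z ∈ K ∧ φ (s z) = z := by
  classical
  have hme : MeasurableEmbedding (fun x : K => e x) := by
    have := isCompact_iff_compactSpace.1 hK
    exact ((he.comp continuous_subtype_val).isClosedEmbedding
      (hinj.comp Subtype.val_injective)).measurableEmbedding
  -- `g` is a Borel left inverse of `e` on `K`, so it is enough to choose the real number `e x`
  -- measurably.
  obtain ⟨g, hg, hge⟩ := hme.exists_measurable_extend (g := Subtype.val) measurable_subtype_coe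
    (fun _ => inferInstance)
  have hge' : ∀ x ∈ K, g (e x) = x := fun x hx => congrFun hge ⟨x, hx⟩
  let S : Z → Set ℝ := fun z => e '' (K ∩ φ ⁻¹' {z})
  have hS : ∀ z, IsCompact (S z) := fun z =>
    (hK.inter_right (isClosed_singleton.preimage hφ)).image he
  -- The fibre point with the least `e`-value is chosen; on `φ '' K` the sublevel sets of `m` are
  -- then continuous images of compact sets.
  let m : Z → ℝ := fun z => if z ∈ φ '' K then sInf (S z) else 0
  have hmem : ∀ z ∈ φ '' K, sInf (S z) ∈ S z := by
    rintro z ⟨x, hx, rfl⟩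
    exact (hS _).sInf_mem ⟨e x, x, ⟨hx, rfl⟩, rfl⟩
  have hφK : MeasurableSet (φ '' K) := (hK.image hφ).measurableSet
  have hm : Measurable m := by
    refine measurable_of_Iic fun a => ?_
    have : m ⁻¹' Iic a = φ '' (K ∩ e ⁻¹' Iic a) ∪ ((φ '' K)ᶜ ∩ {_z | 0 ≤ a}) := by
      ext z
      by_cases hz : z ∈ φ '' K
      · simp only [mem_preimage, m, mem_Iic, if_true, mem_union, mem_inter_iff, mem_compl_iff,
          hz, not_true, false_and, or_false]
        constructor
        · intro h
          obtain ⟨x, ⟨hx, hxz⟩, hxe⟩ := hmem z hz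
          exact ⟨x, ⟨hx, by simpa [hxe] using h⟩, hxz⟩
        · rintro ⟨x, ⟨hx, hxa⟩, rfl⟩
          exact (csInf_le (hS _).bddBelow ⟨x, ⟨hx, rfl⟩, rfl⟩).trans hxa
      · have : z ∉ φ '' (K ∩ e ⁻¹' Iic a) := fun h => hz (image_mono inter_subset_left h)
        simp only [mem_preimage, m, mem_Iic, if_false, mem_union, mem_inter_iff, mem_compl_iff,
          hz, this, not_false_iff, true_and, false_or, mem_ofPred_eq]
    rw [this]
    exact ((hK.inter_right (isClosed_Iic.preimage he)).image hφ).measurableSet.union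
      (hφK.compl.inter (.const _))
  refine ⟨g ∘ m, hg.comp hm, fun z hz => ?_⟩
  obtain ⟨x, ⟨hx, hxz⟩, hxe⟩ := hmem z hz
  have : g (m z) = x := by
    simp only [m, if_pos hz, ← hxe, hge' x hx]
  exact ⟨by simpa [this] using hx, by simpa [this] using hxz⟩

/-- The indicator of the graph embeds Baire space into Cantor space, which sits in the line as the
Cantor set. -/
theorem exists_continuous_injective_nat_pi_real :
    ∃ e : (ℕ → ℕ) → ℝ, Continuous e ∧ Function.Injective e := by
  classical
  let b : (ℕ → ℕ) → ℕ → Bool := fun x n => decide (x n.unpair.1 = n.unpair.2)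
  have hb : Continuous b := by
    refine continuous_pi fun n => ?_
    exact (continuous_of_discreteTopology (f := fun j : ℕ => decide (j = n.unpair.2))).comp
      (continuous_apply _)
  have hbi : Function.Injective b := by
    intro x y h
    ext i
    have := congrFun h (Nat.pair i (y i))
    simpa [b] using this
  exact ⟨fun x => cantorSetHomeomorphNatToBool.symm (b x),
    continuous_subtype_val.comp (cantorSetHomeomorphNatToBool.symm.continuous.comp hb),
    Subtype.val_injective.comp (cantorSetHomeomorphNatToBool.symm.injective.comp hbi)⟩

/-- Counterexamples `x k` agree in their first `k` coordinates with truncations in the compact box,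
so a subsequence converges to a point of the box, hence of `W`. -/
theorem exists_forall_lt_subset_of_isOpen (α : ℕ → ℕ) {W : Set (ℕ → ℕ)} (hW : IsOpen W)
    (h : {x | ∀ i, x i ≤ α i} ⊆ W) : ∃ k, {x : ℕ → ℕ | ∀ i < k, x i ≤ α i} ⊆ W := by
  by_contra! hcon
  simp only [not_subset] at hcon
  choose x hx hxW using hcon
  have hK : IsCompact {x : ℕ → ℕ | ∀ i, x i ≤ α i} := by
    have := isCompact_univ_pi (fun i => (Set.finite_Iic (α i)).isCompact)
    convert this using 1
    ext x; simp [Pi.le_def]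
  obtain ⟨y, hy, φ, hφ, hlim⟩ := hK.tendsto_subseq (x := fun k i => min (x k i) (α i))
    (fun k i => min_le_right _ _)
  have hlim' : Tendsto (fun j => x (φ j)) atTop (𝓝 y) := by
    rw [tendsto_pi_nhds] at hlim ⊢
    intro i
    refine (hlim i).congr' ?_
    filter_upwards [eventually_gt_atTop i] with j hj
    exact min_eq_left (hx (φ j) i (hj.trans_le (hφ.id_le j)))
  obtain ⟨j, hj⟩ := (hlim'.eventually (hW.mem_nhds (h hy))).exists
  exact hxW _ hj

/-- Choquet's capacitability argument: coordinate bounds are fixed one at a time while the measure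
stays above `δ`. The resulting box is compact, and its image is the intersection of the closures of
the images of the cylinders. -/
theorem exists_isCompact_measure_preimage_image_ne_zero {Z : Type*} [TopologicalSpace Z]
    [T2Space Z] [MeasurableSpace Z] [BorelSpace Z] (μ : Measure T) [IsFiniteMeasure μ]
    {c : T → Z} (hc : Measurable c) {φ : (ℕ → ℕ) → Z} (hφ : Continuous φ)
    (h : μ (c ⁻¹' range φ) ≠ 0) : ∃ K, IsCompact K ∧ μ (c ⁻¹' (φ '' K)) ≠ 0 := by
  let E : ℕ → (ℕ → ℕ) → Set (ℕ → ℕ) := fun k b => {x | ∀ i < k, x i ≤ b i}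
  obtain ⟨δ, hδ0, hδ⟩ := exists_between (pos_iff_ne_zero.2 h)
  have step : ∀ k b, δ < μ (c ⁻¹' (φ '' E k b)) →
      ∃ N, δ < μ (c ⁻¹' (φ '' E (k + 1) (Function.update b k N))) := by
    intro k b hb
    have hU : c ⁻¹' (φ '' E k b) = ⋃ N, c ⁻¹' (φ '' E (k + 1) (Function.update b k N)) := by
      rw [← preimage_iUnion, ← image_iUnion]
      congr 2
      ext x
      simp only [E, mem_ofPred_eq, mem_iUnion]
      constructor
      · intro hx
        refine ⟨x k, fun i hi => ?_⟩
        rcases Nat.lt_succ_iff_lt_or_eq.1 hi with hi | rfl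
        · simpa [Function.update_of_ne hi.ne] using hx i hi
        · simp
      · rintro ⟨N, hx⟩ i hi
        simpa [Function.update_of_ne hi.ne] using hx i (hi.trans (Nat.lt_succ_self k))
    have hmono : Monotone fun N => c ⁻¹' (φ '' E (k + 1) (Function.update b k N)) := by
      intro N M hNM
      refine preimage_mono (image_mono fun x hx i hi => (hx i hi).trans ?_)
      exact update_le_update_iff.2 ⟨hNM, fun _ _ => le_rfl⟩ i
    -- Continuity from below needs no measurability of the images. Continuity from above does, which
    -- is why closures appear later.
    rw [hU, hmono.measure_iUnion] at hb
    exact lt_iSup_iff.1 hb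
  choose! N hN using step
  let b : ℕ → ℕ → ℕ := fun k => Nat.rec 0 (fun k b => Function.update b k (N k b)) k
  have hb : ∀ k, b (k + 1) = Function.update (b k) k (N k (b k)) := fun k => rfl
  have hbδ : ∀ k, δ < μ (c ⁻¹' (φ '' E k (b k))) := by
    intro k
    induction k with
    | zero => simpa [E, image_univ] using hδ
    | succ k ih => exact hN k (b k) ih
  let α : ℕ → ℕ := fun i => b (i + 1) i
  have hα : ∀ k, ∀ i < k, b k i = α i := by
    intro k
    induction k with
    | zero => simp
    | succ k ih =>
      intro i hi
      rcases Nat.lt_succ_iff_lt_or_eq.1 hi with hi | rfl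
      · rw [hb, Function.update_of_ne hi.ne, ih i hi]
      · rfl
  have hE : ∀ k, E k (b k) = E k α := fun k => by
    ext x; exact forall₂_congr fun i hi => by rw [hα k i hi]
  let K : Set (ℕ → ℕ) := {x | ∀ i, x i ≤ α i}
  have hK : IsCompact K := by
    have := isCompact_univ_pi (fun i => (Set.finite_Iic (α i)).isCompact)
    convert this using 1
    ext x; simp [K, Pi.le_def]
  refine ⟨K, hK, ?_⟩
  have hinter : φ '' K = ⋂ k, closure (φ '' E k α) := by
    refine subset_antisymm (subset_iInter fun k => (image_mono ?_).trans subset_closure) ?_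
    · exact fun x hx i _ => hx i
    · intro z hz
      by_contra hzK
      obtain ⟨U, V, hU, hV, hzU, hKV, hUV⟩ :=
        (hK.image hφ).separation_of_notMem hzK
      obtain ⟨k, hk⟩ := exists_forall_lt_subset_of_isOpen α (hU.preimage hφ)
        (image_subset_iff.1 hzU)
      have := mem_iInter.1 hz k
      obtain ⟨w, hwV, hwE⟩ := mem_closure_iff.1 this V hV hKV
      exact disjoint_left.1 hUV (image_subset_iff.2 hk hwE) hwV
  have hanti : Antitone fun k => c ⁻¹' closure (φ '' E k α) := fun k l hkl =>
    preimage_mono (closure_mono (image_mono fun x hx i hi => hx i (hi.trans_le hkl)))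
  rw [hinter, preimage_iInter, hanti.measure_iInter
    (fun k => (hc isClosed_closure.measurableSet).nullMeasurableSet) ⟨0, measure_ne_top _ _⟩]
  refine (hδ0.trans_le (le_iInf fun k => ?_)).ne'
  refine (hbδ k).le.trans (measure_mono (preimage_mono ?_))
  rw [hE]
  exact subset_closure

/-- If the projection of a measurable set `B ⊆ T × X` is not null, then `B` has a measurable
selection over a measurable set of positive measure. -/
theorem MeasurableSet.exists_measurable_selection [TopologicalSpace X] [PolishSpace X]
    [MeasurableSpace X] [BorelSpace X] (μ : Measure T) [IsFiniteMeasure μ] {B : Set (T × X)}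
    (hB : MeasurableSet B) (h : μ (Prod.fst '' B) ≠ 0) :
    ∃ (S : Set T) (w : T → X), MeasurableSet S ∧ μ S ≠ 0 ∧ Measurable w ∧
      ∀ t ∈ S, (t, w t) ∈ B := by
  -- This moves the problem into a Polish space, where a Borel set is a continuous image of Baire
  -- space.
  obtain ⟨c, B', hc, hB', rfl⟩ := hB.exists_eq_preimage_prodMap_cantor
  have : PolishSpace (ℕ → Bool) := by
    have := isClosed_cantorSet.polishSpace
    exact cantorSetHomeomorphNatToBool.symm.isClosedEmbedding.polishSpace
  have hana := hB'.analyticSet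
  rw [AnalyticSet] at hana
  rcases hana with rfl | ⟨ψ, hψ, rfl⟩
  · simp at h
  have hφ : Continuous fun a => (ψ a).1 := continuous_fst.comp hψ
  have hproj : Prod.fst '' (Prod.map c id ⁻¹' range ψ) = c ⁻¹' range fun a => (ψ a).1 := by
    ext t
    constructor
    · rintro ⟨⟨t, u⟩, ⟨a, ha⟩, rfl⟩
      exact ⟨a, by simp [ha]⟩
    · rintro ⟨a, ha⟩
      exact ⟨(t, (ψ a).2), ⟨a, Prod.ext ha rfl⟩, rfl⟩
  rw [hproj] at h
  obtain ⟨K, hK, hμK⟩ := exists_isCompact_measure_preimage_image_ne_zero μ hc hφ h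
  obtain ⟨e, he, hinj⟩ := exists_continuous_injective_nat_pi_real
  obtain ⟨s, hs, hsK⟩ := hK.exists_measurable_rightInverse hφ he hinj
  refine ⟨c ⁻¹' ((fun a => (ψ a).1) '' K), fun t => (ψ (s (c t))).2,
    hc (hK.image hφ).measurableSet, hμK,
    (continuous_snd.comp hψ).measurable.comp (hs.comp hc), fun t ht => ?_⟩
  exact ⟨s (c t), Prod.ext (hsK _ ht).2 rfl⟩

/-- A minimizer of an integral functional on `L^p` minimizes the integrand almost everywhere. -/
theorem ae_forall_le_of_forall_lintegral_le [NormedAddCommGroup X] [CompleteSpace X]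
    [SecondCountableTopology X] [MeasurableSpace X] [BorelSpace X] (μ : Measure T)
    [IsFiniteMeasure μ] {p : ENNReal} {h : T → X → ENNReal} (hm : Measurable (Function.uncurry h))
    {v : T → X} (hvm : Measurable v) (hv : MemLp v p μ) (hfin : ∫⁻ t, h t (v t) ∂μ ≠ ⊤)
    (hmin : ∀ w : T → X, Measurable w → MemLp w p μ →
      ∫⁻ t, h t (v t) ∂μ ≤ ∫⁻ t, h t (w t) ∂μ) :
    ∀ᵐ t ∂μ, ∀ u, h t (v t) ≤ h t u := by
  classical
  by_contra hcon
  let B : Set (T × X) := {z | h z.1 z.2 < h z.1 (v z.1)}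
  have hB : MeasurableSet B :=
    measurableSet_lt hm (hm.comp (measurable_fst.prodMk (hvm.comp measurable_fst)))
  have hproj : μ (Prod.fst '' B) ≠ 0 := by
    intro h0
    refine hcon (measure_mono_null (fun t ht => ?_) h0)
    simp only [mem_compl_iff, mem_ofPred_eq, not_forall, not_le] at ht
    obtain ⟨u, hu⟩ := ht
    exact ⟨(t, u), hu, rfl⟩
  obtain ⟨S, w, hS, hμS, hw, hwB⟩ := hB.exists_measurable_selection μ hproj
  -- Restricting to a piece where `w` is bounded keeps the modified competitor in `L^p`.
  have hSU : S = ⋃ n : ℕ, S ∩ {t | ‖w t‖ ≤ n} := by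
    rw [← inter_iUnion]
    refine (inter_eq_left.2 fun t _ => ?_).symm
    obtain ⟨n, hn⟩ := exists_nat_ge ‖w t‖
    exact mem_iUnion.2 ⟨n, hn⟩
  obtain ⟨n, hn⟩ : ∃ n : ℕ, μ (S ∩ {t | ‖w t‖ ≤ n}) ≠ 0 := by
    by_contra! hall
    exact hμS (by rw [hSU]; exact measure_iUnion_null hall)
  set R := S ∩ {t | ‖w t‖ ≤ n} with hR
  have hRm : MeasurableSet R := hS.inter (measurableSet_le hw.norm measurable_const)
  have hpw : Measurable (R.piecewise w v) := hw.piecewise hRm hvm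
  have hmem : MemLp (R.piecewise w v) p μ := by
    refine MemLp.piecewise hRm ?_ (hv.restrict _)
    refine MemLp.of_bound hw.aestronglyMeasurable n ?_
    exact (ae_restrict_iff' hRm).2 (ae_of_all _ fun t ht => ht.2)
  refine absurd (hmin _ hpw hmem) (not_le.2 ?_)
  have hle : ∀ t, h t (R.piecewise w v t) ≤ h t (v t) := by
    intro t
    by_cases ht : t ∈ R
    · have : h t (w t) < h t (v t) := hwB t ht.1
      simpa [ht] using this.le
    · simp [ht]
  refine lintegral_strict_mono_of_ae_le_of_ae_lt_on (s := R) ?_ ?_ (ae_of_all _ hle) hn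
    (ae_of_all _ fun t ht => ?_)
  · exact (hm.comp (measurable_id.prodMk hvm)).aemeasurable
  · exact ne_top_of_le_ne_top hfin (lintegral_mono hle)
  · have : h t (w t) < h t (v t) := hwB t ht.1
    simpa [ht] using this

end Selection

/-! ### Differentiability of powers of the norm and of their weighted sums -/

section NormPower

open scoped NNReal ENNReal

variable {X : Type*} [NormedAddCommGroup X] [NormedSpace ℝ X]

/-- Since `p > 1`, `‖u‖^p = o(‖u‖)`; smoothness of the norm plays no role at the origin. -/
theorem hasFDerivAt_norm_rpow_zero {p : ℝ} (hp : 1 < p) :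
    HasFDerivAt (fun u : X => ‖u‖ ^ p) (0 : StrongDual ℝ X) 0 := by
  have h2p : 0 < p - 1 := sub_pos.2 hp
  refine .of_isLittleO ?_
  calc (fun x : X ↦ ‖x‖ ^ p - ‖(0 : X)‖ ^ p - (0 : StrongDual ℝ X) (x - 0))
      = (fun x : X ↦ ‖x‖ ^ p) := by simp [zero_lt_one.trans hp |>.ne']
    _ = (fun x : X ↦ ‖x‖ * ‖x‖ ^ (p - 1)) := by
        ext x
        rw [← Real.rpow_one_add' (norm_nonneg x) (by positivity)]
        ring_nf
    _ =o[𝓝 0] (fun x : X ↦ ‖x‖ * 1) := by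
      refine (Asymptotics.isBigO_refl _ _).mul_isLittleO <|
        (Asymptotics.isLittleO_const_iff <| by simp).mpr ?_
      convert! continuousAt_id.norm.rpow_const (.inr h2p.le) |>.tendsto
      simp [h2p.ne']
    _ =O[𝓝 0] (fun (x : X) ↦ x - 0) := by
      simp_rw [mul_one, Asymptotics.isBigO_norm_left (f' := fun x ↦ x), sub_zero,
        Asymptotics.isBigO_refl]

theorem hasFDerivAt_norm_rpow_of_differentiableAt {p : ℝ} {x : X} (hx : x ≠ 0)
    (h : DifferentiableAt ℝ (fun u : X => ‖u‖) x) :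
    HasFDerivAt (fun u : X => ‖u‖ ^ p) ((p * ‖x‖ ^ (p - 1)) • fderiv ℝ (fun u : X => ‖u‖) x) x :=
  h.hasFDerivAt.rpow_const (.inl (norm_ne_zero_iff.2 hx))

theorem ContDiffOn.differentiableAt_norm
    (hnorm : ContDiffOn ℝ 1 (fun u : X => ‖u‖) {0}ᶜ) {x : X} (hx : x ≠ 0) :
    DifferentiableAt ℝ (fun u : X => ‖u‖) x :=
  (hnorm.contDiffAt (isOpen_compl_singleton.mem_nhds hx)).differentiableAt one_ne_zero

theorem differentiable_norm_rpow_of_contDiffOn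
    (hnorm : ContDiffOn ℝ 1 (fun u : X => ‖u‖) {0}ᶜ) {p : ℝ} (hp : 1 < p) :
    Differentiable ℝ (fun u : X => ‖u‖ ^ p) := by
  intro x
  by_cases hx : x = 0
  · exact hx ▸ (hasFDerivAt_norm_rpow_zero hp).differentiableAt
  · exact (hasFDerivAt_norm_rpow_of_differentiableAt hx
      (hnorm.differentiableAt_norm hx)).differentiableAt

theorem norm_fderiv_norm_rpow_le_of_contDiffOn
    (hnorm : ContDiffOn ℝ 1 (fun u : X => ‖u‖) {0}ᶜ) {p : ℝ} (hp : 1 < p) (x : X) :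
    ‖fderiv ℝ (fun u : X => ‖u‖ ^ p) x‖ ≤ p * ‖x‖ ^ (p - 1) := by
  have hp0 : 0 < p := zero_lt_one.trans hp
  by_cases hx : x = 0
  · rw [hx, (hasFDerivAt_norm_rpow_zero hp).fderiv, norm_zero]
    positivity
  · rw [(hasFDerivAt_norm_rpow_of_differentiableAt hx (hnorm.differentiableAt_norm hx)).fderiv,
      norm_smul, Real.norm_of_nonneg (by positivity)]
    refine mul_le_of_le_one_right (by positivity) ?_
    simpa using norm_fderiv_le_of_lipschitz ℝ (lipschitzWith_one_norm (E := X)) (x₀ := x)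

theorem continuous_fderiv_norm_rpow_of_contDiffOn
    (hnorm : ContDiffOn ℝ 1 (fun u : X => ‖u‖) {0}ᶜ) {p : ℝ} (hp : 1 < p) :
    Continuous (fderiv ℝ (fun u : X => ‖u‖ ^ p)) := by
  rw [continuous_iff_continuousAt]
  intro x
  by_cases hx : x = 0
  · subst hx
    rw [ContinuousAt, (hasFDerivAt_norm_rpow_zero hp).fderiv, tendsto_zero_iff_norm_tendsto_zero]
    refine tendsto_of_tendsto_of_tendsto_of_le_of_le tendsto_const_nhds ?_
      (fun _ ↦ norm_nonneg _) (fun u ↦ norm_fderiv_norm_rpow_le_of_contDiffOn hnorm hp u)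
    suffices ContinuousAt (fun x : X ↦ p * ‖x‖ ^ (p - 1)) 0 by
      simpa [ContinuousAt, sub_ne_zero_of_ne hp.ne'] using this
    fun_prop (discharger := simp [hp.le])
  · have hc : ContinuousAt (fderiv ℝ (fun u : X => ‖u‖)) x :=
      (hnorm.continuousOn_fderiv_of_isOpen isOpen_compl_singleton le_rfl).continuousAt
        (isOpen_compl_singleton.mem_nhds hx)
    have : ContinuousAt
        (fun u : X => (p * ‖u‖ ^ (p - 1)) • fderiv ℝ (fun u : X => ‖u‖) u) x := by
      refine Filter.Tendsto.smul ?_ hc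
      exact continuousAt_const.mul (continuousAt_id.norm.rpow_const (.inl (norm_ne_zero_iff.2 hx)))
    refine this.congr ?_
    filter_upwards [isOpen_compl_singleton.mem_nhds hx] with u hu
    exact (hasFDerivAt_norm_rpow_of_differentiableAt hu
      (hnorm.differentiableAt_norm hu)).fderiv.symm

/-- Lets the exponent `p - 1` of the derivative be dominated by the summable or integrable exponent
`p`. -/
theorem Real.rpow_le_one_add_rpow {a r s : ℝ} (ha : 0 ≤ a) (hr : 0 ≤ r) (hrs : r ≤ s) :
    a ^ r ≤ 1 + a ^ s := by
  rcases le_total a 1 with h | h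
  · exact (Real.rpow_le_one ha h hr).trans (by linarith [Real.rpow_nonneg ha s])
  · exact (Real.rpow_le_rpow_of_exponent_le h hrs).trans (by linarith)

/-- By convexity `(a+b)^p ≤ 2^(p-1)(a^p+b^p)`. Finiteness of the perturbation at one point thus
spreads to every other point. -/
theorem summable_mul_norm_sub_rpow {E : Type*} [NormedAddCommGroup E] {p : ℝ} (hp : 1 < p)
    {δ : ℕ → ℝ≥0} (hδ : Summable δ) {z : ℕ → E} {v : E} (hv : Summable fun i => (δ i : ℝ) * ‖v - z i‖ ^ p) {ι : ℕ → ℝ} {C : ℝ}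
    (hι : ∀ i, 0 ≤ ι i ∧ ι i ≤ ‖v - z i‖ + C) (hC : 0 ≤ C) :
    Summable fun i => (δ i : ℝ) * ι i ^ p := by
  have hp0 : 0 < p := zero_lt_one.trans hp
  have hδ' : Summable fun i => (δ i : ℝ) := NNReal.summable_coe.2 hδ
  refine Summable.of_nonneg_of_le (fun i => mul_nonneg (δ i).2 (Real.rpow_nonneg (hι i).1 _))
    (fun i => ?_) ((hv.add (hδ'.mul_right (C ^ p))).mul_left ((2 : ℝ) ^ (p - 1)))
  have h1 : ι i ^ p ≤ 2 ^ (p - 1) * (‖v - z i‖ ^ p + C ^ p) := by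
    refine (Real.rpow_le_rpow (hι i).1 (hι i).2 hp0.le).trans ?_
    lift C to ℝ≥0 using hC
    exact_mod_cast NNReal.rpow_add_le_mul_rpow_add_rpow ‖v - z i‖₊ C hp.le
  calc (δ i : ℝ) * ι i ^ p ≤ δ i * (2 ^ (p - 1) * (‖v - z i‖ ^ p + C ^ p)) := by gcongr
    _ = _ := by ring

/-- Termwise differentiation on the unit ball about `v`, with derivatives dominated by `δ i * p * (1
+ (‖v - z i‖ + 1) ^ p)`. -/
theorem hasFDerivAt_tsum_mul_norm_sub_rpow
    (hnorm : ContDiffOn ℝ 1 (fun u : X => ‖u‖) {0}ᶜ) {p : ℝ} (hp : 1 < p)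
    {δ : ℕ → ℝ≥0} (hδ : Summable δ) {z : ℕ → X} {v : X}
    (hv : Summable fun i => (δ i : ℝ) * ‖v - z i‖ ^ p) :
    HasFDerivAt (fun u => ∑' i, (δ i : ℝ) * ‖u - z i‖ ^ p)
      (∑' i, (δ i : ℝ) • fderiv ℝ (fun u : X => ‖u‖ ^ p) (v - z i)) v := by
  have hp0 : 0 < p := zero_lt_one.trans hp
  have hδ' : Summable fun i => (δ i : ℝ) := NNReal.summable_coe.2 hδ
  have hsum := summable_mul_norm_sub_rpow hp hδ hv (ι := fun i => ‖v - z i‖ + 1) (C := 1)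
    (fun i => ⟨by positivity, le_rfl⟩) zero_le_one
  refine hasFDerivAt_tsum_of_isPreconnected (𝕜 := ℝ) (s := Metric.ball v 1)
    (f := fun i u => (δ i : ℝ) * ‖u - z i‖ ^ p)
    (f' := fun i u => (δ i : ℝ) • fderiv ℝ (fun u : X => ‖u‖ ^ p) (u - z i))
    ((hδ'.add hsum).mul_left p) Metric.isOpen_ball (convex_ball v 1).isPreconnected ?_ ?_
    (Metric.mem_ball_self one_pos) hv (Metric.mem_ball_self one_pos)
  · intro i u _
    have := ((differentiable_norm_rpow_of_contDiffOn hnorm hp) (u - z i)).hasFDerivAt.comp u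
      ((hasFDerivAt_id u).sub_const (z i))
    exact (this.const_mul (δ i : ℝ)).congr_fderiv (by simp)
  · intro i u hu
    have h1 : ‖u - z i‖ ≤ ‖v - z i‖ + 1 := by
      have : u - z i = (v - z i) + (u - v) := by abel
      rw [this]
      exact (norm_add_le _ _).trans (by gcongr; exact (mem_ball_iff_norm.1 hu).le)
    rw [norm_smul, NNReal.norm_eq]
    have h2 := norm_fderiv_norm_rpow_le_of_contDiffOn hnorm hp (u - z i)
    have h3 : ‖u - z i‖ ^ (p - 1) ≤ 1 + (‖v - z i‖ + 1) ^ p :=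
      (Real.rpow_le_rpow (norm_nonneg _) h1 (by linarith)).trans
        (Real.rpow_le_one_add_rpow (by positivity) (by linarith) (by linarith))
    calc (δ i : ℝ) * _ ≤ δ i * (p * (1 + (‖v - z i‖ + 1) ^ p)) := by
          gcongr
          exact h2.trans (by gcongr)
      _ = _ := by ring

/-- Hölder's inequality for `δ_i a^(p-1) = δ_i^(1/p) (δ_i a^p)^(1/q)` with `∑ δ_i ≤ 1`. It bounds
the `L^q` norm of the perturbation's derivative by the perturbation's own integral. -/
theorem tsum_enorm_smul_fderiv_norm_rpow_le
    (hnorm : ContDiffOn ℝ 1 (fun u : X => ‖u‖) {0}ᶜ) {p q : ℝ} (hpq : p.HolderConjugate q)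
    {δ : ℕ → ℝ≥0} (hδ1 : ∑' i, (δ i : ℝ≥0∞) ≤ 1) {y : ℕ → X} :
    ∑' i, ‖(δ i : ℝ) • fderiv ℝ (fun u : X => ‖u‖ ^ p) (y i)‖ₑ ≤
      ENNReal.ofReal p * (∑' i, (δ i : ℝ≥0∞) * ‖y i‖ₑ ^ p) ^ (1 / q) := by
  have hp := hpq.lt
  have hp0 := hpq.pos
  have hq0 := hpq.symm.pos
  have hterm : ∀ i, ‖(δ i : ℝ) • fderiv ℝ (fun u : X => ‖u‖ ^ p) (y i)‖ₑ ≤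
      ENNReal.ofReal p * ((δ i : ℝ≥0∞) ^ (1 / p) *
        ((δ i : ℝ≥0∞) * ‖y i‖ₑ ^ p) ^ (1 / q)) := by
    intro i
    have h1 : ‖fderiv ℝ (fun u : X => ‖u‖ ^ p) (y i)‖ₑ ≤ ENNReal.ofReal p * ‖y i‖ₑ ^ (p - 1) := by
      rw [← ofReal_norm (y i), ENNReal.ofReal_rpow_of_nonneg (norm_nonneg _) (by linarith),
        ← ENNReal.ofReal_mul hp0.le, ← ofReal_norm]
      exact ENNReal.ofReal_le_ofReal (norm_fderiv_norm_rpow_le_of_contDiffOn hnorm hp _)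
    have h2 : (δ i : ℝ≥0∞) ^ (1 / p) * ((δ i : ℝ≥0∞) * ‖y i‖ₑ ^ p) ^ (1 / q) =
        δ i * ‖y i‖ₑ ^ (p - 1) := by
      rw [ENNReal.mul_rpow_of_nonneg _ _ (by positivity), ← mul_assoc, ← ENNReal.rpow_mul]
      have e1 : p * (1 / q) = p - 1 := by
        have := hpq.sub_one_mul_conj
        field_simp
        linarith
      rw [e1, ← ENNReal.rpow_add_of_nonneg _ _ (by positivity) (by positivity)]
      have e2 : 1 / p + 1 / q = 1 := by simpa using hpq.inv_add_inv_eq_one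
      rw [e2, ENNReal.rpow_one]
    rw [h2, enorm_smul, mul_left_comm]
    refine mul_le_mul' ?_ h1
    rw [← ofReal_norm, NNReal.norm_eq, ENNReal.ofReal_coe_nnreal]
  calc ∑' i, ‖(δ i : ℝ) • fderiv ℝ (fun u : X => ‖u‖ ^ p) (y i)‖ₑ
      ≤ ∑' i, ENNReal.ofReal p * ((δ i : ℝ≥0∞) ^ (1 / p) *
        ((δ i : ℝ≥0∞) * ‖y i‖ₑ ^ p) ^ (1 / q)) := ENNReal.tsum_le_tsum hterm
    _ = ENNReal.ofReal p * ∑' i, ((δ i : ℝ≥0∞) ^ (1 / p) *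
        ((δ i : ℝ≥0∞) * ‖y i‖ₑ ^ p) ^ (1 / q)) := ENNReal.tsum_mul_left
    _ ≤ ENNReal.ofReal p * (∑' i, (δ i : ℝ≥0∞) * ‖y i‖ₑ ^ p) ^ (1 / q) := by
      gcongr
      have h := ENNReal.lintegral_mul_le_Lp_mul_Lq (Measure.count : Measure ℕ) hpq
        (f := fun i => (δ i : ℝ≥0∞) ^ (1 / p))
        (g := fun i => ((δ i : ℝ≥0∞) * ‖y i‖ₑ ^ p) ^ (1 / q))
        (measurable_of_countable _).aemeasurable (measurable_of_countable _).aemeasurable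
      simp only [lintegral_count, Pi.mul_apply, ← ENNReal.rpow_mul, one_div,
        inv_mul_cancel₀ hp0.ne', inv_mul_cancel₀ hq0.ne', ENNReal.rpow_one] at h
      simp only [one_div]
      refine h.trans (mul_le_of_le_one_left' ?_)
      exact ENNReal.rpow_le_one hδ1 (by positivity)

end NormPower

/-! ### The smooth variational principle -/

section BorweinPreiss

open scoped NNReal ENNReal

theorem exists_le_iInf_add_of_ne_top {E : Type*} (G : E → ℝ≥0∞) (z : E) (hz : G z ≠ ⊤)
    {η : ℝ≥0∞} (hη : 0 < η) : ∃ z', G z' ≤ G z ∧ G z' ≤ (⨅ x, G x) + η := by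
  by_cases h : G z ≤ (⨅ x, G x) + η
  · exact ⟨z, le_rfl, h⟩
  · push Not at h
    have hlt : (⨅ x, G x) < (⨅ x, G x) + η :=
      ENNReal.lt_add_right (ne_top_of_le_ne_top hz (iInf_le _ _)) hη.ne'
    obtain ⟨z', hz'⟩ := iInf_lt_iff.1 hlt
    exact ⟨z', hz'.le.trans h.le, hz'.le⟩

/-- The Borwein-Preiss variational principle for the gauge `edist ^ p`. -/
theorem LowerSemicontinuous.exists_forall_add_tsum_edist_rpow_le {E : Type*} [EMetricSpace E]
    [CompleteSpace E] {F : E → ℝ≥0∞} (hF : LowerSemicontinuous F) (hfin : ∃ z, F z ≠ ⊤)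
    {ε : ℝ≥0∞} (hε : 0 < ε) {p : ℝ} (hp : 0 < p) {δ : ℕ → ℝ≥0} (hδ : ∀ i, 0 < δ i) :
    ∃ (z : ℕ → E) (v : E),
      (∀ x, F v + ∑' i, (δ i : ℝ≥0∞) * edist v (z i) ^ p ≤
        F x + ∑' i, (δ i : ℝ≥0∞) * edist x (z i) ^ p) ∧
      F v + ∑' i, (δ i : ℝ≥0∞) * edist v (z i) ^ p ≤ (⨅ x, F x) + ε := by
  obtain ⟨z₀, hz₀⟩ := hfin
  -- The choice is made total, with its conditions moved into the conclusion, so that it can be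
  -- iterated by plain recursion.
  have hpick : ∀ (η : ℝ≥0∞) (G : E → ℝ≥0∞) (z : E), ∃ z', 0 < η → G z ≠ ⊤ →
      G z' ≤ G z ∧ G z' ≤ (⨅ x, G x) + η := by
    intro η G z
    by_cases h : 0 < η ∧ G z ≠ ⊤
    · obtain ⟨z', hz'⟩ := exists_le_iInf_add_of_ne_top G z h.2 h.1
      exact ⟨z', fun _ _ => hz'⟩
    · exact ⟨z, fun h1 h2 => absurd ⟨h1, h2⟩ h⟩
  choose pick hpick using hpick
  let η : ℕ → ℝ≥0∞ := fun i => 2⁻¹ ^ i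
  have hη : ∀ i, 0 < η i := fun i => ENNReal.pow_pos (by simp) i
  have hηt : ∀ i, η i ≠ ⊤ := fun i => ENNReal.pow_ne_top (by simp)
  have hη0 : Tendsto η atTop (𝓝 0) :=
    ENNReal.tendsto_pow_atTop_nhds_zero_of_lt_one (by simp)
  -- The tolerance `δ i * η i ^ p` forces the sets `S i` below to have radius at most `η i`; the
  -- minimum with `ε` gives the final estimate.
  let ε' : ℕ → ℝ≥0∞ := fun i => min ε (δ i * η i ^ p)
  have hε' : ∀ i, 0 < ε' i := fun i =>
    lt_min hε (ENNReal.mul_pos (by exact_mod_cast (hδ i).ne')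
      (ENNReal.rpow_pos (hη i) (hηt i)).ne')
  -- The state holds the current functional and a near-minimizer of it; each step adds a penalty
  -- centred at that point.
  let st : ℕ → (E → ℝ≥0∞) × E := fun i => Nat.rec (F, pick (ε' 0) F z₀)
    (fun i s => (fun x => s.1 x + δ i * edist x s.2 ^ p,
      pick (ε' (i + 1)) (fun x => s.1 x + δ i * edist x s.2 ^ p) s.2)) i
  let G : ℕ → E → ℝ≥0∞ := fun i => (st i).1
  let z : ℕ → E := fun i => (st i).2
  have hG0 : G 0 = F := rfl
  have hGs : ∀ i x, G (i + 1) x = G i x + δ i * edist x (z i) ^ p := fun i x => rfl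
  have hz0 : z 0 = pick (ε' 0) (G 0) z₀ := rfl
  have hzs : ∀ i, z (i + 1) = pick (ε' (i + 1)) (G (i + 1)) (z i) := fun i => rfl
  clear_value G z
  have hGz : ∀ i, G (i + 1) (z i) = G i (z i) := fun i => by simp [hGs, hp]
  have hz : ∀ i, G i (z i) ≠ ⊤ ∧ G i (z i) ≤ (⨅ x, G i x) + ε' i ∧
      G (i + 1) (z (i + 1)) ≤ G i (z i) := by
    intro i
    induction i with
    | zero =>
      have h := hpick (ε' 0) (G 0) z₀ (hε' 0) (hG0 ▸ hz₀)
      rw [← hz0] at h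
      have ht : G 0 (z 0) ≠ ⊤ := ne_top_of_le_ne_top (hG0 ▸ hz₀) h.1
      refine ⟨ht, h.2, ?_⟩
      have h1 := hpick (ε' 1) (G 1) (z 0) (hε' 1) (by rwa [hGz])
      rw [← hzs, hGz] at h1
      exact h1.1
    | succ i ih =>
      have h := hpick (ε' (i + 1)) (G (i + 1)) (z i) (hε' _) (by rw [hGz]; exact ih.1)
      rw [← hzs, hGz] at h
      have ht := ne_top_of_le_ne_top ih.1 h.1
      refine ⟨ht, h.2, ?_⟩
      have h1 := hpick (ε' (i + 2)) (G (i + 2)) (z (i + 1)) (hε' _) (by rwa [hGz])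
      rw [← hzs, hGz] at h1
      exact h1.1
  have hzanti : Antitone fun i => G i (z i) := antitone_nat_of_succ_le fun i => (hz i).2.2
  have hGmono : ∀ x, Monotone fun i => G i x := fun x =>
    monotone_nat_of_le_succ fun i => by rw [hGs]; exact le_self_add
  have hGlsc : ∀ i, LowerSemicontinuous (G i) := by
    intro i
    induction i with
    | zero => rwa [hG0]
    | succ i ih =>
      have : G (i + 1) = fun x => G i x + δ i * edist x (z i) ^ p := funext (hGs i)
      rw [this]
      refine ih.add (Continuous.lowerSemicontinuous ?_)
      exact (ENNReal.continuous_const_mul ENNReal.coe_ne_top).comp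
        (ENNReal.continuous_rpow_const.comp (continuous_id.edist continuous_const))
  let S : ℕ → Set E := fun i => {x | G (i + 1) x ≤ G i (z i)}
  have hSclosed : ∀ i, IsClosed (S i) := fun i => (hGlsc (i + 1)).isClosed_preimage _
  have hSdist : ∀ i, ∀ x ∈ S i, edist x (z i) ≤ η i := by
    intro i x hx
    have hx' : G (i + 1) x ≤ G i (z i) := hx
    have ht : G i x ≠ ⊤ := ne_top_of_le_ne_top (hz i).1 ((hGmono x i.le_succ).trans hx')
    rw [hGs] at hx'
    have h1 : G i x + δ i * edist x (z i) ^ p ≤ G i x + δ i * η i ^ p :=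
      hx'.trans ((hz i).2.1.trans (add_le_add (iInf_le _ _) (min_le_right _ _)))
    have h2 := (ENNReal.add_le_add_iff_left ht).1 h1
    rw [ENNReal.mul_le_mul_iff_right (by exact_mod_cast (hδ i).ne') ENNReal.coe_ne_top] at h2
    exact (ENNReal.rpow_le_rpow_iff hp).1 h2
  have hzS : ∀ i j, i < j → z j ∈ S i := by
    intro i j hij
    change G (i + 1) (z j) ≤ G i (z i)
    calc G (i + 1) (z j) ≤ G j (z j) := hGmono _ hij
      _ ≤ G i (z i) := hzanti hij.le
  have hcauchy : CauchySeq z := by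
    rw [EMetric.cauchySeq_iff']
    intro r hr
    obtain ⟨N, hN⟩ := (hη0.eventually (gt_mem_nhds hr)).exists
    refine ⟨N, fun n hn => ?_⟩
    rcases hn.eq_or_lt with rfl | hn
    · simpa using hr
    · exact (hSdist N _ (hzS N n hn)).trans_lt hN
  obtain ⟨v, hv⟩ := cauchySeq_tendsto_of_complete hcauchy
  have hvS : ∀ i, v ∈ S i := fun i => (hSclosed i).mem_of_tendsto hv
    ((eventually_gt_atTop i).mono fun j hj => hzS i j hj)
  have hsum : ∀ x i, G i x = F x + ∑ j ∈ Finset.range i, (δ j : ℝ≥0∞) * edist x (z j) ^ p := by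
    intro x i
    induction i with
    | zero => simp [hG0]
    | succ i ih => rw [hGs, ih, Finset.sum_range_succ, add_assoc]
  have hsup : ∀ x, F x + ∑' i, (δ i : ℝ≥0∞) * edist x (z i) ^ p = ⨆ i, G i x := by
    intro x
    simp_rw [hsum, ENNReal.tsum_eq_iSup_nat, ENNReal.add_iSup]
  have hvz : ∀ i j, G i v ≤ G j (z j) := by
    intro i j
    calc G i v ≤ G (max i j + 1) v := hGmono v ((le_max_left i j).trans (Nat.le_succ _))
      _ ≤ G (max i j) (z (max i j)) := hvS _
      _ ≤ G j (z j) := hzanti (le_max_right i j)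
  refine ⟨z, v, fun x => ?_, ?_⟩
  · rw [hsup, hsup]
    -- A point in every `S i` is the limit of `z`, hence equals `v`. A point outside some `S j`
    -- already has `G (j + 1) x` above every `G i v`.
    by_cases hx : ∀ i, x ∈ S i
    · have : Tendsto z atTop (𝓝 x) := by
        rw [tendsto_iff_edist_tendsto_0]
        refine tendsto_of_tendsto_of_tendsto_of_le_of_le tendsto_const_nhds hη0
          (fun _ => zero_le) fun i => ?_
        simpa [edist_comm] using hSdist i x (hx i)
      rw [tendsto_nhds_unique hv this]
    · push Not at hx
      obtain ⟨j, hj⟩ := hx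
      have hj' : G j (z j) < G (j + 1) x := not_le.1 hj
      exact iSup_le fun i => (hvz i j).trans (hj'.le.trans (le_iSup (fun i => G i x) (j + 1)))
  · rw [hsup]
    refine iSup_le fun i => (hvz i 0).trans ((hz 0).2.1.trans ?_)
    rw [hG0]
    exact add_le_add le_rfl (min_le_left _ _)

end BorweinPreiss

/-! ### Fréchet subgradients and Fermat's rule -/

section Frechet

open scoped NNReal ENNReal

variable {X : Type*} [NormedAddCommGroup X] [NormedSpace ℝ X]

theorem EReal.le_sub_coe_div_iff {a : EReal} {b c ε r : ℝ} (hr : 0 < r) :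
    ((-ε : ℝ) : EReal) ≤ (a - b - (c : EReal)) / (r : EReal) ↔
      ((b + c - ε * r : ℝ) : EReal) ≤ a := by
  induction a with
  | bot =>
    simp only [EReal.bot_sub, EReal.bot_div_of_pos_ne_top (EReal.coe_pos.2 hr) (EReal.coe_ne_top r),
      le_bot_iff, EReal.coe_ne_bot]
  | top => simp [EReal.top_div_of_pos_ne_top (EReal.coe_pos.2 hr) (EReal.coe_ne_top r)]
  | coe a =>
    rw [← EReal.coe_sub, ← EReal.coe_sub, ← EReal.coe_div, EReal.coe_le_coe_iff,
      EReal.coe_le_coe_iff, le_div_iff₀ hr]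
    constructor <;> intro h <;> linarith

/-- The `ε`-form avoids extended-real quotients; at `h = 0` the inequality is trivial, so the
neighbourhood need not be punctured. -/
theorem mem_frechetSubdiff_iff {φ : X → EReal} {x : X} {x' : StrongDual ℝ X} :
    x' ∈ frechetSubdiff φ x ↔ φ x ≠ ⊥ ∧ φ x ≠ ⊤ ∧ ∀ ε > (0 : ℝ), ∀ᶠ h in 𝓝 (0 : X),
      (((φ x).toReal + x' h - ε * ‖h‖ : ℝ) : EReal) ≤ φ (x + h) := by
  refine and_congr_right fun hb => and_congr_right fun ht => ?_
  lift φ x to ℝ using ⟨ht, hb⟩ with b hbx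
  rw [le_liminf_iff]
  constructor
  · intro H ε hε
    have h1 := H ((-ε : ℝ) : EReal) (by exact_mod_cast neg_neg_of_pos hε)
    rw [eventually_nhdsWithin_iff] at h1
    filter_upwards [h1] with h hh
    by_cases h0 : h = 0
    · subst h0; simp [← hbx]
    · exact (EReal.le_sub_coe_div_iff (norm_pos_iff.2 h0)).1 (hh h0).le
  · intro H y hy
    obtain ⟨s, hys, hs0⟩ := EReal.lt_iff_exists_real_btwn.1 hy
    have hs0' : 0 < -s := by
      have : s < 0 := by exact_mod_cast hs0
      linarith
    rw [eventually_nhdsWithin_iff]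
    filter_upwards [H (-s) hs0'] with h hh h0
    refine hys.trans_le ?_
    have := (EReal.le_sub_coe_div_iff (ε := -s) (norm_pos_iff.2 h0)).2 hh
    simpa using this

/-- Fermat rule: if `φ + r` has a minimum at `x` and `r` is differentiable at `x`, then the
negative of the derivative of `r` is a Fréchet subgradient of `φ`. -/
theorem neg_mem_frechetSubdiff_of_forall_add_le {φ : X → EReal} {r : X → ℝ} {x : X}
    {A : StrongDual ℝ X} (hb : φ x ≠ ⊥) (ht : φ x ≠ ⊤) (hr : HasFDerivAt r A x)
    (hmin : ∀ u, φ x + (r x : EReal) ≤ φ u + (r u : EReal)) : -A ∈ frechetSubdiff φ x := by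
  refine mem_frechetSubdiff_iff.2 ⟨hb, ht, fun ε hε => ?_⟩
  have h1 := (hasFDerivAt_iff_isLittleO_nhds_zero.1 hr).def hε
  filter_upwards [h1] with h hh
  have h2 := hmin (x + h)
  have h3 : r (x + h) - r x - A h ≤ ε * ‖h‖ := (Real.le_norm_self _).trans hh
  lift φ x to ℝ using ⟨ht, hb⟩ with b hbx
  generalize φ (x + h) = a at h2
  induction a with
  | bot =>
    rw [EReal.bot_add, ← EReal.coe_add, le_bot_iff] at h2
    exact absurd h2 (EReal.coe_ne_bot _)
  | top => exact le_top
  | coe a =>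
    norm_cast at h2 ⊢
    simp only [EReal.toReal_coe, neg_apply]
    linarith

theorem mem_frechetSubdiff_comp_const_add {φ : X → EReal} {x v : X} {x' : StrongDual ℝ X} :
    x' ∈ frechetSubdiff (fun u => φ (x + u)) v ↔ x' ∈ frechetSubdiff φ (x + v) := by
  simp only [frechetSubdiff, add_assoc, mem_ofPred_eq]

end Frechet

/-! ### The penalized integrand -/

section Integrand

open scoped NNReal ENNReal

variable {T X : Type*} [NormedAddCommGroup X]

/-- The integrand `f(t, v) + ‖v - y‖ ^ p + k(t) ‖y‖ + c(t)`. -/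
noncomputable def penalizedIntegrand (f : T → X → EReal) (p : ℝ) (k c : T → ℝ) (t : T) (v y : X) :
    ℝ≥0∞ :=
  (f t v + ((‖v - y‖ ^ p + k t * ‖y‖ + c t : ℝ) : EReal)).toENNReal

theorem EReal.continuous_add_coe : Continuous fun z : EReal × ℝ => z.1 + (z.2 : EReal) := by
  rw [continuous_iff_continuousAt]
  intro z
  exact (EReal.continuousAt_add (p := (z.1, (z.2 : EReal))) (.inr (by simp)) (.inr (by simp))).comp
    (f := fun z : EReal × ℝ => (z.1, (z.2 : EReal)))
    (continuous_fst.prodMk (continuous_coe_real_ereal.comp continuous_snd)).continuousAt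

theorem measurable_penalizedIntegrand [MeasurableSpace T] [MeasurableSpace X] [BorelSpace X]
    [SecondCountableTopology X] {f : T → X → EReal} (hf : Measurable (Function.uncurry f)) {p : ℝ}
    {k c : T → ℝ} (hk : Measurable k) (hc : Measurable c) :
    Measurable fun z : T × X × X => penalizedIntegrand f p k c z.1 z.2.1 z.2.2 := by
  have h1 : Measurable fun z : T × X × X => f z.1 z.2.1 :=
    hf.comp (measurable_fst.prodMk (measurable_fst.comp measurable_snd))
  have h2 : Measurable fun z : T × X × X =>
      ‖z.2.1 - z.2.2‖ ^ p + k z.1 * ‖z.2.2‖ + c z.1 := by fun_prop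
  exact (EReal.continuous_add_coe.measurable.comp (h1.prodMk h2)).ereal_toENNReal

theorem lowerSemicontinuous_penalizedIntegrand {f : T → X → EReal} {t : T}
    (hf : LowerSemicontinuous (f t)) {p : ℝ} (hp : 0 ≤ p) (k c : T → ℝ) :
    LowerSemicontinuous fun z : X × X => penalizedIntegrand f p k c t z.1 z.2 := by
  have h2 : Continuous fun z : X × X =>
      ((‖z.1 - z.2‖ ^ p + k t * ‖z.2‖ + c t : ℝ) : EReal) := by
    refine continuous_coe_real_ereal.comp ?_
    have : Continuous fun z : X × X => ‖z.1 - z.2‖ ^ p :=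
      (by fun_prop : Continuous fun z : X × X => ‖z.1 - z.2‖).rpow_const fun _ => .inr hp
    fun_prop
  have h3 := (hf.comp (continuous_fst (X := X) (Y := X))).add' h2.lowerSemicontinuous
    (fun z => EReal.continuousAt_add (.inr (EReal.coe_ne_bot _)) (.inr (EReal.coe_ne_top _)))
  exact EReal.continuous_toENNReal.comp_lowerSemicontinuous h3
    (fun _ _ h => EReal.toENNReal_le_toENNReal h)

/-- Truncation by `toENNReal` loses nothing where the sum is nonnegative, which will hold for almost
every `t`. -/
theorem coe_penalizedIntegrand {f : T → X → EReal} {p : ℝ} {k c : T → ℝ} {t : T} {v y : X}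
    (h : 0 ≤ f t v + ((‖v - y‖ ^ p + k t * ‖y‖ + c t : ℝ) : EReal)) :
    (penalizedIntegrand f p k c t v y : EReal) =
      f t v + ((‖v - y‖ ^ p + k t * ‖y‖ + c t : ℝ) : EReal) :=
  EReal.coe_toENNReal h

end Integrand

/-! ### Lower semicontinuity and limits of integrals -/

section LimitLemmas

open scoped NNReal ENNReal

/-- A Scheffé argument: the deficits `h - hn` are dominated by `h` and tend to `0`. The excesses are
then controlled through `h + (hn - h) = hn + (h - hn)`. -/
theorem tendsto_lintegral_tsub_add_tsub_of_le_liminf {T : Type*} [MeasurableSpace T]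
    {μ : Measure T} {h : T → ℝ≥0∞} {hn : ℕ → T → ℝ≥0∞} {e : ℕ → ℝ≥0∞}
    (hm : AEMeasurable h μ) (hnm : ∀ n, AEMeasurable (hn n) μ) (hfin : ∫⁻ t, h t ∂μ ≠ ⊤)
    (hlim : ∀ᵐ t ∂μ, h t ≤ liminf (fun n => hn n t) atTop)
    (hle : ∀ n, ∫⁻ t, hn n t ∂μ ≤ ∫⁻ t, h t ∂μ + e n) (he : Tendsto e atTop (𝓝 0)) :
    Tendsto (fun n => ∫⁻ t, (hn n t - h t) ∂μ + ∫⁻ t, (h t - hn n t) ∂μ) atTop (𝓝 0) := by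
  have h1 : Tendsto (fun n => ∫⁻ t, (h t - hn n t) ∂μ) atTop (𝓝 0) := by
    have := tendsto_lintegral_of_dominated_convergence' (μ := μ)
      (F := fun n t => h t - hn n t) (f := fun _ => 0) h
      (fun n => hm.sub (hnm n)) (fun n => ae_of_all _ fun t => tsub_le_self) hfin ?_
    · simpa using this
    filter_upwards [hlim, ae_lt_top' hm hfin] with t ht hfint
    rw [ENNReal.tendsto_nhds_zero]
    intro ε hε
    rcases eq_or_ne (h t) 0 with h0 | h0
    · simp [h0]
    have hlt : h t - ε < liminf (fun n => hn n t) atTop :=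
      (ENNReal.sub_lt_self hfint.ne h0 hε.ne').trans_le ht
    filter_upwards [eventually_lt_of_lt_liminf hlt] with n hn
    rw [tsub_le_iff_left]
    rw [← tsub_le_iff_right]
    exact hn.le
  have h2 : ∀ n, ∫⁻ t, (hn n t - h t) ∂μ ≤ e n + ∫⁻ t, (h t - hn n t) ∂μ := by
    intro n
    have h3 : ∫⁻ t, h t ∂μ + ∫⁻ t, (hn n t - h t) ∂μ =
        ∫⁻ t, hn n t ∂μ + ∫⁻ t, (h t - hn n t) ∂μ := by
      rw [← lintegral_add_left' hm, ← lintegral_add_left' (hnm n)]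
      refine lintegral_congr fun t => ?_
      rw [add_tsub_eq_max, add_tsub_eq_max, max_comm]
    refine (ENNReal.add_le_add_iff_left hfin).1 ?_
    rw [h3, ← add_assoc]
    gcongr
    exact hle n
  have h4 : Tendsto (fun n => (e n + ∫⁻ t, (h t - hn n t) ∂μ) + ∫⁻ t, (h t - hn n t) ∂μ) atTop
      (𝓝 0) := by simpa using (he.add h1).add h1
  exact tendsto_of_tendsto_of_tendsto_of_le_of_le tendsto_const_nhds h4 (fun _ => zero_le)
    fun n => add_le_add (h2 n) le_rfl

/-- A strict lower bound on `{v} × K` persists on a tube around it. This eliminates the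
finite-dimensional variable before the variational principle is applied. -/
theorem LowerSemicontinuous.iInf_mem_isCompact {E Y : Type*} [TopologicalSpace E]
    [TopologicalSpace Y] {K : Set Y} (hK : IsCompact K) {Ψ : E → Y → ℝ≥0∞}
    (hΨ : LowerSemicontinuous (Function.uncurry Ψ)) :
    LowerSemicontinuous fun v => ⨅ y ∈ K, Ψ v y := by
  intro v a ha
  obtain ⟨b, hab, hb⟩ := exists_between ha
  have hopen : IsOpen {z : E × Y | b < Function.uncurry Ψ z} := hΨ.isOpen_preimage b
  obtain ⟨U, V, hU, hV, hvU, hKV, hUV⟩ := generalized_tube_lemma (isCompact_singleton (x := v)) hK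
    hopen (by
      rintro ⟨w, y⟩ ⟨hw, hy⟩
      obtain rfl : w = v := hw
      exact hb.trans_le (iInf₂_le y hy))
  filter_upwards [hU.mem_nhds (hvU rfl)] with w hw
  refine hab.trans_le (le_iInf₂ fun y hy => ?_)
  have : b < Ψ w y := hUV (mk_mem_prod hw (hKV hy))
  exact this.le

theorem exists_mem_iInf_eq_of_isCompact {Y : Type*} [TopologicalSpace Y] {K : Set Y}
    (hK : IsCompact K) (hne : K.Nonempty) {ψ : Y → ℝ≥0∞} (hψ : LowerSemicontinuous ψ) :
    ∃ y ∈ K, ∀ y' ∈ K, ψ y ≤ ψ y' := by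
  obtain ⟨y, hy, hmin⟩ := (hψ.lowerSemicontinuousOn K).exists_isMinOn hne hK
  exact ⟨y, hy, fun y' hy' => hmin hy'⟩

theorem LowerSemicontinuous.le_liminf_of_tendsto {α : Type*} [TopologicalSpace α] {F : α → ℝ≥0∞}
    (hF : LowerSemicontinuous F) {u : ℕ → α} {a : α} (hu : Tendsto u atTop (𝓝 a)) :
    F a ≤ liminf (fun n => F (u n)) atTop :=
  (hF.le_liminf a).trans hu.liminf_le_liminf_comp

/-- Lower semicontinuity of integral functionals on `L^p`, jointly in a parameter. -/
theorem lowerSemicontinuous_lintegral_Lp {T X Y : Type*} [MeasurableSpace T] {μ : Measure T}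
    [NormedAddCommGroup X] [MeasurableSpace X] [BorelSpace X] [SecondCountableTopology X]
    [TopologicalSpace Y] [FirstCountableTopology Y]
    {p : ℝ≥0∞} [Fact (1 ≤ p)] {H : T → X → Y → ℝ≥0∞}
    (hm : ∀ y, Measurable fun z : T × X => H z.1 z.2 y)
    (hlsc : ∀ t, LowerSemicontinuous fun z : X × Y => H t z.1 z.2) :
    LowerSemicontinuous fun z : Lp X p μ × Y => ∫⁻ t, H t (z.1 t) z.2 ∂μ := by
  rw [lowerSemicontinuous_iff_isClosed_preimage]
  intro a
  refine IsSeqClosed.isClosed fun u z hu hz => ?_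
  have h1 : Tendsto (fun n => (u n).1) atTop (𝓝 z.1) := (continuous_fst.tendsto z).comp hz
  have h2 : Tendsto (fun n => (u n).2) atTop (𝓝 z.2) := (continuous_snd.tendsto z).comp hz
  -- Almost everywhere convergence along a subsequence reduces the claim to Fatou's lemma.
  obtain ⟨ns, hns, hae⟩ := (tendstoInMeasure_of_tendsto_Lp h1).exists_seq_tendsto_ae
  change ∫⁻ t, H t (z.1 t) z.2 ∂μ ≤ a
  calc ∫⁻ t, H t (z.1 t) z.2 ∂μ
      ≤ ∫⁻ t, liminf (fun n => H t ((u (ns n)).1 t) (u (ns n)).2) atTop ∂μ := by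
        refine lintegral_mono_ae ?_
        filter_upwards [hae] with t ht
        exact (hlsc t).le_liminf_of_tendsto (ht.prodMk_nhds (h2.comp hns.tendsto_atTop))
    _ ≤ liminf (fun n => ∫⁻ t, H t ((u (ns n)).1 t) (u (ns n)).2 ∂μ) atTop :=
        lintegral_liminf_le' fun n => ((hm _).comp
          (measurable_id.prodMk (Lp.stronglyMeasurable _).measurable)).aemeasurable
    _ ≤ a := by
        refine liminf_le_of_frequently_le' (Frequently.of_forall fun n => hu (ns n))

end LimitLemmas

/-! ### Perturbed minimizers and their convergence -/

section Minimizers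

open scoped NNReal ENNReal

variable {T X : Type*} [MeasurableSpace T] {μ : Measure T} [NormedAddCommGroup X]

theorem eLpNorm_ofReal_rpow {E : Type*} [NormedAddCommGroup E] {p : ℝ} (hp : 0 < p) (w : T → E) :
    eLpNorm w (ENNReal.ofReal p) μ ^ p = ∫⁻ t, ‖w t‖ₑ ^ p ∂μ := by
  rw [eLpNorm_eq_lintegral_rpow_enorm_toReal (by simpa using hp) ENNReal.ofReal_ne_top,
    ENNReal.toReal_ofReal hp.le, ← ENNReal.rpow_mul, one_div, inv_mul_cancel₀ hp.ne',
    ENNReal.rpow_one]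

/-- Existence of minimizers of a perturbed integral functional on `L^p × K`. -/
theorem exists_perturbed_minimizer [MeasurableSpace X] [BorelSpace X] [SecondCountableTopology X]
    [CompleteSpace X] {p : ℝ} (hp : 1 < p) {H : T → X → X → ℝ≥0∞}
    (hm : ∀ y, Measurable fun z : T × X => H z.1 z.2 y)
    (hlsc : ∀ t, LowerSemicontinuous fun z : X × X => H t z.1 z.2) {θ : X → ℝ≥0∞}
    (hθ : LowerSemicontinuous θ) {K : Set X} (hK : IsCompact K) (h0K : (0 : X) ∈ K)
    (hfin : ∫⁻ t, H t 0 0 ∂μ + θ 0 ≠ ⊤) {ε : ℝ≥0∞} (hε : 0 < ε) (hεt : ε ≠ ⊤) {δ : ℕ → ℝ≥0}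
    (hδ : ∀ i, 0 < δ i) :
    ∃ (z : ℕ → T → X) (v : T → X) (y : X), (∀ i, StronglyMeasurable (z i)) ∧
      StronglyMeasurable v ∧ MemLp v (ENNReal.ofReal p) μ ∧ y ∈ K ∧
      (∀ w : T → X, StronglyMeasurable w → MemLp w (ENNReal.ofReal p) μ → ∀ y' ∈ K,
        ∫⁻ t, H t (v t) y ∂μ + θ y + ∫⁻ t, ∑' i, (δ i : ℝ≥0∞) * ‖v t - z i t‖ₑ ^ p ∂μ ≤
        ∫⁻ t, H t (w t) y' ∂μ + θ y' + ∫⁻ t, ∑' i, (δ i : ℝ≥0∞) * ‖w t - z i t‖ₑ ^ p ∂μ) ∧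
      ∫⁻ t, H t (v t) y ∂μ + θ y + ∫⁻ t, ∑' i, (δ i : ℝ≥0∞) * ‖v t - z i t‖ₑ ^ p ∂μ ≤
        ∫⁻ t, H t 0 0 ∂μ + θ 0 + ε ∧
      ∫⁻ t, ∑' i, (δ i : ℝ≥0∞) * ‖v t - z i t‖ₑ ^ p ∂μ ≤ ε := by
  have hp0 : 0 < p := zero_lt_one.trans hp
  have : Fact (1 ≤ ENNReal.ofReal p) := ⟨by simpa using ENNReal.ofReal_le_ofReal hp.le⟩
  let Ψ : Lp X (ENNReal.ofReal p) μ → X → ℝ≥0∞ := fun v y => ∫⁻ t, H t (v t) y ∂μ + θ y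
  have hΨ : LowerSemicontinuous (Function.uncurry Ψ) :=
    (lowerSemicontinuous_lintegral_Lp hm hlsc).add (hθ.comp continuous_snd)
  have hF := hΨ.iInf_mem_isCompact hK
  have hzero : ⨅ y ∈ K, Ψ 0 y ≤ ∫⁻ t, H t 0 0 ∂μ + θ 0 := by
    refine (iInf₂_le 0 h0K).trans (le_of_eq ?_)
    refine congrArg (· + θ 0) (lintegral_congr_ae ?_)
    filter_upwards [Lp.coeFn_zero X (ENNReal.ofReal p) μ] with t ht
    rw [ht, Pi.zero_apply]
  -- The principle is applied to the marginal in `v` only, so no perturbation in `y` is created; `y`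
  -- is then an exact minimizer over `K`.
  obtain ⟨z, v, hmin, hle⟩ := hF.exists_forall_add_tsum_edist_rpow_le
    ⟨0, ne_top_of_le_ne_top hfin hzero⟩ hε hp0 hδ
  obtain ⟨y, hyK, hy⟩ := exists_mem_iInf_eq_of_isCompact hK ⟨0, h0K⟩
    (hΨ.comp (Continuous.prodMk_right v))
  have hFv : ⨅ y ∈ K, Ψ v y = Ψ v y :=
    le_antisymm (iInf₂_le y hyK) (le_iInf₂ hy)
  have hP : ∀ (w : Lp X (ENNReal.ofReal p) μ) (w' : T → X), w =ᵐ[μ] w' →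
      ∑' i, (δ i : ℝ≥0∞) * edist w (z i) ^ p =
        ∫⁻ t, ∑' i, (δ i : ℝ≥0∞) * ‖w' t - z i t‖ₑ ^ p ∂μ := by
    intro w w' hww'
    have hmeas : ∀ i, AEMeasurable (fun t => ‖w t - z i t‖ₑ ^ p) μ := fun i =>
      (((Lp.stronglyMeasurable w).sub (Lp.stronglyMeasurable (z i))).enorm.pow_const p).aemeasurable
    calc ∑' i, (δ i : ℝ≥0∞) * edist w (z i) ^ p
        = ∑' i, ∫⁻ t, (δ i : ℝ≥0∞) * ‖w t - z i t‖ₑ ^ p ∂μ := by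
          refine tsum_congr fun i => ?_
          rw [Lp.edist_def, eLpNorm_ofReal_rpow hp0, lintegral_const_mul'' _ (hmeas i)]
          rfl
      _ = ∫⁻ t, ∑' i, (δ i : ℝ≥0∞) * ‖w t - z i t‖ₑ ^ p ∂μ :=
          (lintegral_tsum fun i => (hmeas i).const_mul _).symm
      _ = _ := by
          refine lintegral_congr_ae ?_
          filter_upwards [hww'] with t ht
          rw [ht]
  -- Bounding the infimum by the value at `v` itself and cancelling that finite value leaves the
  -- perturbation at most `ε`.
  have hPε := hle.trans (add_le_add (iInf_le _ v) le_rfl)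
  have hFvt : ⨅ y ∈ K, Ψ v y ≠ ⊤ := by
    refine ne_top_of_le_ne_top ?_ (le_self_add.trans (hle.trans
      (add_le_add ((iInf_le _ 0).trans hzero) le_rfl)))
    exact ENNReal.add_ne_top.2 ⟨hfin, hεt⟩
  replace hPε := (ENNReal.add_le_add_iff_left hFvt).1 hPε
  rw [hP v v (ae_eq_refl _)] at hPε
  rw [hFv, hP v v (ae_eq_refl _)] at hmin hle
  refine ⟨fun i => z i, v, y, fun i => Lp.stronglyMeasurable _, Lp.stronglyMeasurable _,
    Lp.memLp v, hyK, fun w _ hwp y' hy' => ?_, hle.trans ?_, hPε⟩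
  · refine (hmin (hwp.toLp w)).trans ?_
    rw [hP _ w hwp.coeFn_toLp]
    refine add_le_add ((iInf₂_le y' hy').trans (le_of_eq ?_)) le_rfl
    refine congrArg (· + θ y') (lintegral_congr_ae ?_)
    filter_upwards [hwp.coeFn_toLp] with t ht
    rw [ht]
  · gcongr
    exact (iInf_le _ 0).trans hzero

/-- Penalized near-minimizers converge to the strict minimizer along a subsequence. -/
theorem exists_subseq_tendsto_of_penalized_le [MeasurableSpace X] [BorelSpace X]
    [SecondCountableTopology X] {p : ℝ} (hp : 1 < p) {h : T → X → X → ℝ≥0∞}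
    (hm : ∀ y, Measurable fun z : T × X => h z.1 z.2 y)
    (hlsc : ∀ t, LowerSemicontinuous fun z : X × X => h t z.1 z.2) {θ : X → ℝ≥0∞}
    (hθ : Continuous θ) (hθt : ∀ y, θ y ≠ ⊤) {K : Set X} (hK : IsCompact K) {ε : ℝ} (hε : 0 < ε)
    (hfin : ∫⁻ t, h t 0 0 ∂μ ≠ ⊤)
    (hgrowth : ∀ y ∈ K, ∫⁻ t, h t 0 0 ∂μ + θ 0 + ENNReal.ofReal (ε * ‖y‖) ≤
      ∫⁻ t, h t y y ∂μ + θ y)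
    {v : ℕ → T → X} {y : ℕ → X} (hv : ∀ n, StronglyMeasurable (v n)) (hy : ∀ n, y n ∈ K)
    {e : ℕ → ℝ≥0∞} (he : Tendsto e atTop (𝓝 0)) (het : ∀ n, e n ≤ 1)
    (hle : ∀ n : ℕ, ∫⁻ t, h t (v n t) (y n) ∂μ + n * ∫⁻ t, ‖v n t - y n‖ₑ ^ p ∂μ + θ (y n) ≤
      ∫⁻ t, h t 0 0 ∂μ + θ 0 + e n) :
    ∃ φ : ℕ → ℕ, StrictMono φ ∧ Tendsto (fun j => y (φ j)) atTop (𝓝 0) ∧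
      Tendsto (fun j => (φ j : ℝ≥0∞) * ∫⁻ t, ‖v (φ j) t - y (φ j)‖ₑ ^ p ∂μ) atTop (𝓝 0) ∧
      Tendsto (fun j => ∫⁻ t, (h t (v (φ j) t) (y (φ j)) - h t 0 0) ∂μ +
        ∫⁻ t, (h t 0 0 - h t (v (φ j) t) (y (φ j))) ∂μ) atTop (𝓝 0) := by
  have hp0 : 0 < p := zero_lt_one.trans hp
  set J := ∫⁻ t, h t 0 0 ∂μ with hJ
  have hMt : J + θ 0 + 1 ≠ ⊤ := by simp [hfin, hθt]
  have hpen : Tendsto (fun n => ∫⁻ t, ‖v n t - y n‖ₑ ^ p ∂μ) atTop (𝓝 0) := by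
    have h1 : ∀ n : ℕ, (n : ℝ≥0∞) * ∫⁻ t, ‖v n t - y n‖ₑ ^ p ∂μ ≤ J + θ 0 + 1 := fun n =>
      calc _ ≤ ∫⁻ t, h t (v n t) (y n) ∂μ + n * ∫⁻ t, ‖v n t - y n‖ₑ ^ p ∂μ + θ (y n) :=
            le_add_self.trans le_self_add
        _ ≤ J + θ 0 + e n := hle n
        _ ≤ _ := by gcongr; exact het n
    refine tendsto_of_tendsto_of_tendsto_of_le_of_le' tendsto_const_nhds
      (h := fun n : ℕ => (J + θ 0 + 1) / n) ?_ (Eventually.of_forall fun _ => zero_le) ?_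
    · simpa using ENNReal.Tendsto.const_div ENNReal.tendsto_nat_nhds_top (.inr hMt)
    · filter_upwards [eventually_gt_atTop 0] with n hn
      rw [ENNReal.le_div_iff_mul_le (.inl (by exact_mod_cast hn.ne'))
        (.inl (ENNReal.natCast_ne_top n)), mul_comm]
      exact h1 n
  obtain ⟨ybar, hybar, φ₁, hφ₁, hlim₁⟩ := hK.tendsto_subseq hy
  have hmeas : TendstoInMeasure μ (fun n t => v (φ₁ n) t - y (φ₁ n)) atTop fun _ => 0 := by
    refine tendstoInMeasure_of_tendsto_eLpNorm (p := ENNReal.ofReal p) (by simpa using hp0)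
      (fun n => ((hv _).sub stronglyMeasurable_const).aestronglyMeasurable)
      aestronglyMeasurable_const ?_
    have h2 := (hpen.comp hφ₁.tendsto_atTop).ennrpow_const (1 / p)
    rw [ENNReal.zero_rpow_of_pos (by positivity)] at h2
    refine h2.congr fun n => ?_
    have h3 := eLpNorm_ofReal_rpow (μ := μ) hp0
      ((fun t => v (φ₁ n) t - y (φ₁ n)) - fun _ => (0 : X))
    simp only [Pi.sub_apply, sub_zero] at h3
    simp only [Function.comp_apply, ← h3, ← ENNReal.rpow_mul, mul_one_div_cancel hp0.ne',
      ENNReal.rpow_one]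
  obtain ⟨φ₂, hφ₂, hae⟩ := hmeas.exists_seq_tendsto_ae
  let φ := φ₁ ∘ φ₂
  have hφ : StrictMono φ := hφ₁.comp hφ₂
  have hyφ : Tendsto (fun j => y (φ j)) atTop (𝓝 ybar) := hlim₁.comp hφ₂.tendsto_atTop
  have hvφ : ∀ᵐ t ∂μ, Tendsto (fun j => v (φ j) t) atTop (𝓝 ybar) := by
    filter_upwards [hae] with t ht
    simpa [φ] using ht.add hyφ
  have hhm : ∀ j, AEMeasurable (fun t => h t (v (φ j) t) (y (φ j))) μ := fun j =>
    ((hm _).comp (measurable_id.prodMk (hv _).measurable)).aemeasurable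
  have hlimh : ∀ᵐ t ∂μ, h t ybar ybar ≤ liminf (fun j => h t (v (φ j) t) (y (φ j))) atTop := by
    filter_upwards [hvφ] with t ht
    exact (hlsc t).le_liminf_of_tendsto (ht.prodMk_nhds hyφ)
  have heφ : Tendsto (fun j => e (φ j)) atTop (𝓝 0) := he.comp hφ.tendsto_atTop
  have hθφ : Tendsto (fun j => θ (y (φ j))) atTop (𝓝 (θ ybar)) := (hθ.tendsto _).comp hyφ
  have hsub : ∀ j, ∫⁻ t, h t (v (φ j) t) (y (φ j)) ∂μ +
      (φ j : ℝ≥0∞) * ∫⁻ t, ‖v (φ j) t - y (φ j)‖ₑ ^ p ∂μ ≤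
      J + θ 0 + e (φ j) - θ (y (φ j)) := fun j =>
    ENNReal.le_sub_of_add_le_right (hθt _) (hle _)
  have hRlim : Tendsto (fun j => J + θ 0 + e (φ j) - θ (y (φ j))) atTop
      (𝓝 (J + θ 0 - θ ybar)) := by
    refine ENNReal.Tendsto.sub ?_ hθφ (.inr (hθt _))
    simpa using tendsto_const_nhds.add heφ
  have hbar : ∫⁻ t, h t ybar ybar ∂μ ≤ J + θ 0 - θ ybar := by
    calc ∫⁻ t, h t ybar ybar ∂μ
        ≤ ∫⁻ t, liminf (fun j => h t (v (φ j) t) (y (φ j))) atTop ∂μ := lintegral_mono_ae hlimh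
      _ ≤ liminf (fun j => ∫⁻ t, h t (v (φ j) t) (y (φ j)) ∂μ) atTop := lintegral_liminf_le' hhm
      _ ≤ liminf (fun j => J + θ 0 + e (φ j) - θ (y (φ j))) atTop :=
          liminf_le_liminf (Eventually.of_forall fun j => le_self_add.trans (hsub j))
      _ = _ := hRlim.liminf_eq
  -- In the limit the value at `ybar` is at most the value at `0`, so the linear growth excludes
  -- `ybar ≠ 0`.
  have hybar0 : ybar = 0 := by
    have h1 := hgrowth ybar hybar
    have h2 : θ ybar ≤ J + θ 0 := by
      refine le_of_tendsto_of_tendsto' hθφ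
        (by simpa using (tendsto_const_nhds (x := J + θ 0)).add heφ) fun j => ?_
      exact le_add_self.trans (hle (φ j))
    have h3 : ∫⁻ t, h t ybar ybar ∂μ + θ ybar ≤ J + θ 0 := by
      calc _ ≤ (J + θ 0 - θ ybar) + θ ybar := by gcongr
        _ = _ := tsub_add_cancel_of_le h2
    have h4 : J + θ 0 + ENNReal.ofReal (ε * ‖ybar‖) ≤ J + θ 0 + 0 := by
      simpa using h1.trans h3
    have h5 := (ENNReal.add_le_add_iff_left (by simp [hfin, hθt])).1 h4
    have h6 : ε * ‖ybar‖ ≤ 0 := by simpa using h5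
    exact norm_le_zero_iff.1 (by nlinarith [norm_nonneg ybar])
  subst hybar0
  -- The admissible excess over `J`; it vanishes in the limit because `θ (y (φ j))` tends to `θ 0`.
  let e' : ℕ → ℝ≥0∞ := fun j => (J + θ 0 + e (φ j) - θ (y (φ j))) - J
  have he' : Tendsto e' atTop (𝓝 0) := by
    have := ENNReal.Tendsto.sub hRlim (tendsto_const_nhds (x := J)) (.inr hfin)
    rwa [ENNReal.add_sub_cancel_right (hθt 0), tsub_self] at this
  have hsub' : ∀ j, ∫⁻ t, h t (v (φ j) t) (y (φ j)) ∂μ +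
      (φ j : ℝ≥0∞) * ∫⁻ t, ‖v (φ j) t - y (φ j)‖ₑ ^ p ∂μ ≤ J + e' j := fun j =>
    (hsub j).trans le_add_tsub
  have hmain := tendsto_lintegral_tsub_add_tsub_of_le_liminf
    ((hm 0).comp (measurable_id.prodMk measurable_const)).aemeasurable hhm hfin hlimh
    (fun j => le_self_add.trans (hsub' j)) he'
  refine ⟨φ, hφ, hyφ, ?_, hmain⟩
  have hup := he'.add hmain
  rw [add_zero] at hup
  refine tendsto_of_tendsto_of_tendsto_of_le_of_le tendsto_const_nhds hup
    (fun _ => zero_le) fun j => ?_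
  set A := ∫⁻ t, h t (v (φ j) t) (y (φ j)) ∂μ with hA
  have hAt : A ≠ ⊤ := by
    refine ne_top_of_le_ne_top ?_ (le_self_add.trans (hsub j))
    refine ne_top_of_le_ne_top ?_ tsub_le_self
    refine ne_top_of_le_ne_top hMt ?_
    gcongr
    exact het _
  -- The penalty is at most the excess plus the deficit of `A` below `J`, and both tend to `0`.
  have hJA : J ≤ A + ∫⁻ t, (h t 0 0 - h t (v (φ j) t) (y (φ j))) ∂μ := by
    rw [hA, ← lintegral_add_left' (hhm j)]
    exact lintegral_mono fun t => le_add_tsub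
  refine (ENNReal.add_le_add_iff_left hAt).1 ((hsub' j).trans ?_)
  calc J + e' j ≤ (A + ∫⁻ t, (h t 0 0 - h t (v (φ j) t) (y (φ j))) ∂μ) + e' j := by gcongr
    _ = A + (e' j + ∫⁻ t, (h t 0 0 - h t (v (φ j) t) (y (φ j))) ∂μ) := by ring
    _ ≤ _ := by gcongr; exact le_add_self

end Minimizers

/-! ### Euler inclusion in `L^p` and differentiation in the finite-dimensional variable -/

section Stationarity

open scoped NNReal ENNReal

variable {T X : Type*} [MeasurableSpace T] {μ : Measure T} [NormedAddCommGroup X] [NormedSpace ℝ X]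

theorem eLpNorm_le_of_enorm_le_rpow {E : Type*} [NormedAddCommGroup E] {q C : ℝ} (hq : 0 < q)
    {D : T → E} {P : T → ℝ≥0∞} (h : ∀ t, ‖D t‖ₑ ≤ ENNReal.ofReal C * P t ^ (1 / q)) :
    eLpNorm D (ENNReal.ofReal q) μ ≤ ENNReal.ofReal C * (∫⁻ t, P t ∂μ) ^ (1 / q) := by
  rw [eLpNorm_eq_lintegral_rpow_enorm_toReal (by simpa using hq) ENNReal.ofReal_ne_top,
    ENNReal.toReal_ofReal hq.le]
  have h1 : ∫⁻ t, ‖D t‖ₑ ^ q ∂μ ≤ ENNReal.ofReal C ^ q * ∫⁻ t, P t ∂μ := by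
    rw [← lintegral_const_mul' _ _ (ENNReal.rpow_ne_top_of_nonneg hq.le ENNReal.ofReal_ne_top)]
    refine lintegral_mono fun t => ?_
    calc ‖D t‖ₑ ^ q ≤ (ENNReal.ofReal C * P t ^ (1 / q)) ^ q := by gcongr; exact h t
      _ = _ := by
        rw [ENNReal.mul_rpow_of_nonneg _ _ hq.le, ← ENNReal.rpow_mul, one_div_mul_cancel hq.ne',
          ENNReal.rpow_one]
  calc _ ≤ (ENNReal.ofReal C ^ q * ∫⁻ t, P t ∂μ) ^ (1 / q) := by gcongr
    _ = _ := by
      rw [ENNReal.mul_rpow_of_nonneg _ _ (by positivity), ← ENNReal.rpow_mul,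
        mul_one_div_cancel hq.ne', ENNReal.rpow_one]

theorem enorm_fderiv_norm_rpow_le_rpow_one_div
    (hnorm : ContDiffOn ℝ 1 (fun u : X => ‖u‖) {0}ᶜ) {p q : ℝ} (hpq : p.HolderConjugate q) (u : X) :
    ‖fderiv ℝ (fun u : X => ‖u‖ ^ p) u‖ₑ ≤ ENNReal.ofReal p * (‖u‖ₑ ^ p) ^ (1 / q) := by
  have hp := hpq.lt
  have e1 : p * (1 / q) = p - 1 := by
    have := hpq.sub_one_mul_conj
    have := hpq.symm.pos
    field_simp
    linarith
  rw [← ENNReal.rpow_mul, e1, ← ofReal_norm u,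
    ENNReal.ofReal_rpow_of_nonneg (norm_nonneg _) (by linarith),
    ← ENNReal.ofReal_mul hpq.pos.le, ← ofReal_norm]
  exact ENNReal.ofReal_le_ofReal (norm_fderiv_norm_rpow_le_of_contDiffOn hnorm hp _)

/-- Finiteness of the integrated perturbation makes the series of derivatives absolutely convergent
almost everywhere, so it is an a.e. limit of measurable partial sums. -/
theorem aestronglyMeasurable_tsum_smul_fderiv_norm_rpow [MeasurableSpace X] [BorelSpace X]
    [SecondCountableTopology X]
    (hnorm : ContDiffOn ℝ 1 (fun u : X => ‖u‖) {0}ᶜ) {p q : ℝ} (hpq : p.HolderConjugate q)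
    {δ : ℕ → ℝ≥0} (hδ1 : ∑' i, (δ i : ℝ≥0∞) ≤ 1) {y : ℕ → T → X}
    (hy : ∀ i, StronglyMeasurable (y i))
    (hfin : ∫⁻ t, ∑' i, (δ i : ℝ≥0∞) * ‖y i t‖ₑ ^ p ∂μ ≠ ⊤) :
    AEStronglyMeasurable
      (fun t => ∑' i, (δ i : ℝ) • fderiv ℝ (fun u : X => ‖u‖ ^ p) (y i t)) μ := by
  have hDc := continuous_fderiv_norm_rpow_of_contDiffOn hnorm hpq.lt
  have hD : ∀ i, StronglyMeasurable
      fun t => (δ i : ℝ) • fderiv ℝ (fun u : X => ‖u‖ ^ p) (y i t) := fun i =>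
    (hDc.comp_stronglyMeasurable (hy i)).const_smul (δ i : ℝ)
  have hPm : Measurable fun t => ∑' i, (δ i : ℝ≥0∞) * ‖y i t‖ₑ ^ p :=
    Measurable.tsum fun i => ((hy i).enorm.pow_const p).const_mul _
  refine aestronglyMeasurable_of_tendsto_ae atTop
    (f := fun n t => ∑ i ∈ Finset.range n, (δ i : ℝ) • fderiv ℝ (fun u : X => ‖u‖ ^ p) (y i t))
    (fun n => (Finset.stronglyMeasurable_fun_sum _ fun i _ => hD i).aestronglyMeasurable) ?_
  filter_upwards [ae_lt_top hPm hfin] with t ht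
  have hs : Summable fun i => (δ i : ℝ) • fderiv ℝ (fun u : X => ‖u‖ ^ p) (y i t) := by
    refine Summable.of_enorm (ne_top_of_le_ne_top ?_
      (tsum_enorm_smul_fderiv_norm_rpow_le hnorm hpq hδ1 (y := fun i => y i t)))
    exact ENNReal.mul_ne_top ENNReal.ofReal_ne_top
      (ENNReal.rpow_ne_top_of_nonneg (one_div_nonneg.2 hpq.symm.pos.le) ht.ne)
  exact hs.hasSum.tendsto_sum_nat

theorem summable_mul_norm_rpow_of_ne_top {E : Type*} [NormedAddCommGroup E] {δ : ℕ → ℝ≥0}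
    {y : ℕ → E} {p : ℝ} (h : ∑' i, (δ i : ℝ≥0∞) * ‖y i‖ₑ ^ p ≠ ⊤) : Summable fun i => (δ i : ℝ) * ‖y i‖ ^ p := by
  refine (ENNReal.summable_toReal h).congr fun i => ?_
  simp [ENNReal.toReal_mul, ← ENNReal.toReal_rpow]

theorem coe_tsum_mul_enorm_rpow {E : Type*} [NormedAddCommGroup E] {δ : ℕ → ℝ≥0}
    {y : ℕ → E} {p : ℝ} (hp : 0 ≤ p) (h : Summable fun i => (δ i : ℝ) * ‖y i‖ ^ p) :
    ((∑' i, (δ i : ℝ≥0∞) * ‖y i‖ₑ ^ p : ℝ≥0∞) : EReal) =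
      ((∑' i, (δ i : ℝ) * ‖y i‖ ^ p : ℝ) : EReal) := by
  have h0 : ∀ i, 0 ≤ (δ i : ℝ) * ‖y i‖ ^ p := fun i => by positivity
  rw [← EReal.coe_ennreal_ofReal.trans (congrArg _ (max_eq_left (tsum_nonneg h0))),
    ENNReal.ofReal_tsum_of_nonneg h0 h]
  congr 2
  ext1 i
  rw [ENNReal.ofReal_mul (NNReal.coe_nonneg _), ENNReal.ofReal_coe_nnreal,
    ← ENNReal.ofReal_rpow_of_nonneg (norm_nonneg _) hp, ofReal_norm]

/-- The Euler inclusion for minimizers of the perturbed integral functional on `L^p`. -/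
theorem ae_mem_frechetSubdiff_of_minimizer [IsFiniteMeasure μ] [CompleteSpace X]
    [MeasurableSpace X] [BorelSpace X] [SecondCountableTopology X]
    (hnorm : ContDiffOn ℝ 1 (fun u : X => ‖u‖) {0}ᶜ) {p : ℝ} (hp : 1 < p)
    {δ : ℕ → ℝ≥0} (hδ : Summable δ) {f : T → X → EReal} (hf : Measurable (Function.uncurry f))
    {k c : T → ℝ} (hk : Measurable k) (hc : Measurable c)
    (hgood : ∀ᵐ t ∂μ, ∀ v y : X,
      0 ≤ f t v + ((‖v - y‖ ^ p + k t * ‖y‖ + c t : ℝ) : EReal))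
    {n : ℕ} {v : T → X} {y : X} {z : ℕ → T → X} (hv : StronglyMeasurable v)
    (hvp : MemLp v (ENNReal.ofReal p) μ) (hz : ∀ i, StronglyMeasurable (z i))
    (hfin : ∫⁻ t, (penalizedIntegrand f p k c t (v t) y + n * ‖v t - y‖ₑ ^ p) ∂μ +
        ∫⁻ t, ∑' i, (δ i : ℝ≥0∞) * ‖v t - z i t‖ₑ ^ p ∂μ ≠ ⊤)
    (hmin : ∀ w : T → X, StronglyMeasurable w → MemLp w (ENNReal.ofReal p) μ →
      ∫⁻ t, (penalizedIntegrand f p k c t (v t) y + n * ‖v t - y‖ₑ ^ p) ∂μ +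
        ∫⁻ t, ∑' i, (δ i : ℝ≥0∞) * ‖v t - z i t‖ₑ ^ p ∂μ ≤
      ∫⁻ t, (penalizedIntegrand f p k c t (w t) y + n * ‖w t - y‖ₑ ^ p) ∂μ +
        ∫⁻ t, ∑' i, (δ i : ℝ≥0∞) * ‖w t - z i t‖ₑ ^ p ∂μ) :
    ∀ᵐ t ∂μ, -((n + 1 : ℝ) • fderiv ℝ (fun u : X => ‖u‖ ^ p) (v t - y) +
      ∑' i, (δ i : ℝ) • fderiv ℝ (fun u : X => ‖u‖ ^ p) (v t - z i t)) ∈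
        frechetSubdiff (f t) (v t) := by
  have hp0 : 0 < p := zero_lt_one.trans hp
  let G : T → X → ℝ≥0∞ := fun t u =>
    penalizedIntegrand f p k c t u y + n * ‖u - y‖ₑ ^ p +
      ∑' i, (δ i : ℝ≥0∞) * ‖u - z i t‖ₑ ^ p
  have hH : Measurable fun a : T × X =>
      penalizedIntegrand f p k c a.1 a.2 y + n * ‖a.2 - y‖ₑ ^ p := by
    refine Measurable.add ?_ ?_
    · exact (measurable_penalizedIntegrand hf hk hc).comp
        (measurable_fst.prodMk (measurable_snd.prodMk measurable_const))
    · exact ((measurable_snd.sub_const y).enorm.pow_const p).const_mul _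
  have hP : Measurable fun a : T × X => ∑' i, (δ i : ℝ≥0∞) * ‖a.2 - z i a.1‖ₑ ^ p :=
    Measurable.tsum fun i =>
      ((measurable_snd.sub ((hz i).measurable.comp measurable_fst)).enorm.pow_const p).const_mul _
  have hGm : Measurable (Function.uncurry G) := hH.add hP
  have hGint : ∀ w : T → X, Measurable w → ∫⁻ t, G t (w t) ∂μ =
      ∫⁻ t, (penalizedIntegrand f p k c t (w t) y + n * ‖w t - y‖ₑ ^ p) ∂μ +
        ∫⁻ t, ∑' i, (δ i : ℝ≥0∞) * ‖w t - z i t‖ₑ ^ p ∂μ := fun w hw =>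
    lintegral_add_left (hH.comp (measurable_id.prodMk hw)) _
  have hGfin : ∫⁻ t, G t (v t) ∂μ ≠ ⊤ := by rwa [hGint v hv.measurable]
  have hpt := ae_forall_le_of_forall_lintegral_le μ hGm hv.measurable hvp hGfin
    (fun w hw hwp => by
      rw [hGint v hv.measurable, hGint w hw]
      exact hmin w hw.stronglyMeasurable hwp)
  filter_upwards [hpt, hgood, ae_lt_top (hGm.comp (measurable_id.prodMk hv.measurable)) hGfin]
    with t hmin_t hgood_t hfin_t
  have hGt : G t (v t) ≠ ⊤ := hfin_t.ne
  have hPt : ∑' i, (δ i : ℝ≥0∞) * ‖v t - z i t‖ₑ ^ p ≠ ⊤ := (ENNReal.add_ne_top.1 hGt).2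
  have hht : penalizedIntegrand f p k c t (v t) y ≠ ⊤ :=
    (ENNReal.add_ne_top.1 (ENNReal.add_ne_top.1 hGt).1).1
  have hsv := summable_mul_norm_rpow_of_ne_top hPt
  have hsu : ∀ u, Summable fun i => (δ i : ℝ) * ‖u - z i t‖ ^ p := fun u =>
    summable_mul_norm_sub_rpow hp hδ hsv (ι := fun i => ‖u - z i t‖) (C := ‖u - v t‖)
      (fun i => ⟨norm_nonneg _, by
        have : u - z i t = (v t - z i t) + (u - v t) := by abel
        rw [this]; exact norm_add_le _ _⟩) (norm_nonneg _)
  -- The coefficient is `n + 1`: `n` from the explicit penalty and `1` from the power already inside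
  -- `penalizedIntegrand`.
  let r : X → ℝ := fun u => (n + 1 : ℝ) * ‖u - y‖ ^ p +
    (∑' i, (δ i : ℝ) * ‖u - z i t‖ ^ p) + (k t * ‖y‖ + c t)
  have hGr : ∀ u, (G t u : EReal) = f t u + (r u : EReal) := by
    intro u
    have e1 : ((n * ‖u - y‖ₑ ^ p : ℝ≥0∞) : EReal) = ((n * ‖u - y‖ ^ p : ℝ) : EReal) := by
      have h0 : (0 : ℝ) ≤ n * ‖u - y‖ ^ p := by positivity
      rw [← EReal.coe_ennreal_ofReal.trans (congrArg _ (max_eq_left h0)),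
        ENNReal.ofReal_mul (Nat.cast_nonneg n), ENNReal.ofReal_natCast,
        ← ENNReal.ofReal_rpow_of_nonneg (norm_nonneg _) hp0.le, ofReal_norm]
    simp only [G]
    rw [EReal.coe_ennreal_add, EReal.coe_ennreal_add, coe_penalizedIntegrand (hgood_t u y), e1,
      coe_tsum_mul_enorm_rpow hp0.le (hsu u), add_assoc, add_assoc, ← EReal.coe_add,
      ← EReal.coe_add]
    congr 2
    simp only [r]
    ring
  have hb : f t (v t) ≠ ⊥ := by
    intro h
    have := hgood_t (v t) y
    rw [h, EReal.bot_add] at this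
    exact absurd this (by simp)
  have hft : f t (v t) ≠ ⊤ := by
    intro h
    have := hGr (v t)
    rw [h, EReal.top_add_coe, EReal.coe_ennreal_eq_top_iff] at this
    exact hGt this
  have hr : HasFDerivAt r ((n + 1 : ℝ) • fderiv ℝ (fun u : X => ‖u‖ ^ p) (v t - y) +
      ∑' i, (δ i : ℝ) • fderiv ℝ (fun u : X => ‖u‖ ^ p) (v t - z i t)) (v t) := by
    have h1 := ((differentiable_norm_rpow_of_contDiffOn hnorm hp) (v t - y)).hasFDerivAt.comp (v t)
      ((hasFDerivAt_id (v t)).sub_const y)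
    have h2 := hasFDerivAt_tsum_mul_norm_sub_rpow hnorm hp hδ hsv
    exact ((h1.const_mul (n + 1 : ℝ)).add h2).add_const _
  refine neg_mem_frechetSubdiff_of_forall_add_le hb hft hr fun u => ?_
  rw [← hGr, ← hGr]
  exact EReal.coe_ennreal_le_coe_ennreal_iff.2 (hmin_t u)

/-- Stationarity along a direction in which a function grows at most linearly. -/
theorem neg_le_apply_of_hasFDerivAt {Γ : X → ℝ} {A : StrongDual ℝ X} {y u : X} {M : ℝ}
    (hΓ : HasFDerivAt Γ A y) (h : ∀ᶠ s in 𝓝[>] (0 : ℝ), Γ y ≤ Γ (y + s • u) + M * s) :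
    -M ≤ A u := by
  have h1 : HasDerivAt (fun s : ℝ => Γ (y + s • u)) (A u) 0 := by
    have h2 : HasDerivAt (fun s : ℝ => y + s • u) u 0 := by
      simpa using ((hasDerivAt_id (0 : ℝ)).smul_const u).const_add y
    exact HasFDerivAt.comp_hasDerivAt (0 : ℝ) (by simpa using hΓ) h2
  have h3 := h1.hasDerivWithinAt (s := Ioi 0)
  rw [hasDerivWithinAt_iff_tendsto_slope' (by simp)] at h3
  refine ge_of_tendsto h3 ?_
  filter_upwards [h, self_mem_nhdsWithin] with s hs (hs0 : 0 < s)
  rw [slope_def_field, le_div_iff₀ (by simpa using hs0)]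
  simp only [zero_smul, add_zero, sub_zero]
  linarith

/-- Differentiation under the integral, with a bound on the unit ball about `y` that is integrable
because `μ` is finite and `v ∈ L^p`. -/
theorem hasFDerivAt_integral_norm_sub_rpow [IsFiniteMeasure μ]
    [MeasurableSpace X] [BorelSpace X] [SecondCountableTopology X]
    (hnorm : ContDiffOn ℝ 1 (fun u : X => ‖u‖) {0}ᶜ) {p : ℝ} (hp : 1 < p) {v : T → X}
    (hv : StronglyMeasurable v) (hvp : MemLp v (ENNReal.ofReal p) μ) (y : X) :
    HasFDerivAt (fun y => ∫ t, ‖v t - y‖ ^ p ∂μ)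
      (∫ t, -fderiv ℝ (fun u : X => ‖u‖ ^ p) (v t - y) ∂μ) y := by
  have hp0 : 0 < p := zero_lt_one.trans hp
  have hDc := continuous_fderiv_norm_rpow_of_contDiffOn hnorm hp
  have hpn : ENNReal.ofReal p ≠ 0 := by simpa using hp0
  have hint : ∀ {w : T → ℝ}, MemLp w (ENNReal.ofReal p) μ → Integrable (fun t => ‖w t‖ ^ p) μ := by
    intro w hw
    simpa [ENNReal.toReal_ofReal hp0.le] using hw.integrable_norm_rpow hpn ENNReal.ofReal_ne_top
  refine hasFDerivAt_integral_of_dominated_of_fderiv_le (𝕜 := ℝ) (s := Metric.ball y 1)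
    (F := fun y t => ‖v t - y‖ ^ p)
    (F' := fun y t => -fderiv ℝ (fun u : X => ‖u‖ ^ p) (v t - y))
    (bound := fun t => p * (1 + ‖‖v t - y‖ + 1‖ ^ p))
    (Metric.ball_mem_nhds y one_pos) ?_ ?_ ?_ ?_ ?_ ?_
  · refine Eventually.of_forall fun w => ?_
    exact ((hv.sub stronglyMeasurable_const).norm.measurable.pow_const p).aestronglyMeasurable
  · simpa using hint (hvp.sub (memLp_const y)).norm
  · exact (hDc.comp_stronglyMeasurable (hv.sub stronglyMeasurable_const)).neg.aestronglyMeasurable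
  · refine ae_of_all _ fun t w hw => ?_
    rw [norm_neg]
    refine (norm_fderiv_norm_rpow_le_of_contDiffOn hnorm hp _).trans ?_
    have h1 : ‖v t - w‖ ≤ ‖v t - y‖ + 1 := by
      have : v t - w = (v t - y) + (y - w) := by abel
      rw [this]
      refine (norm_add_le _ _).trans ?_
      gcongr
      rw [norm_sub_rev]
      exact (mem_ball_iff_norm.1 hw).le
    have h2 : ‖v t - w‖ ^ (p - 1) ≤ 1 + (‖v t - y‖ + 1) ^ p :=
      (Real.rpow_le_rpow (norm_nonneg _) h1 (by linarith)).trans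
        (Real.rpow_le_one_add_rpow (by positivity) (by linarith) (by linarith))
    rw [Real.norm_of_nonneg (by positivity : 0 ≤ ‖v t - y‖ + 1)]
    gcongr
  · exact ((integrable_const 1).add
      (hint ((hvp.sub (memLp_const y)).norm.add (memLp_const 1)))).const_mul p
  · refine ae_of_all _ fun t w _ => ?_
    have h1 := ((differentiable_norm_rpow_of_contDiffOn hnorm hp) (v t - w)).hasFDerivAt.comp w
      ((hasFDerivAt_id w).const_sub (v t))
    exact h1.congr_fderiv (by ext; simp)

end Stationarity

/-! ### Stationarity with respect to the finite-dimensional variable -/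

section Stationarity

open scoped NNReal ENNReal

variable {T X : Type*} [MeasurableSpace T] {μ : Measure T} [NormedAddCommGroup X]

theorem EReal.toENNReal_coe_add_coe (a b : ℝ) :
    ((a : EReal) + (b : EReal)).toENNReal = ENNReal.ofReal (a + b) := by
  rw [← EReal.coe_add, EReal.toENNReal_of_ne_top (EReal.coe_ne_top _), EReal.toReal_coe]

theorem ne_bot_of_zero_le_add_coe {a : EReal} {b : ℝ} (h : 0 ≤ a + (b : EReal)) : a ≠ ⊥ := by
  rintro rfl
  rw [EReal.bot_add] at h
  exact absurd h (by simp)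

/-- Almost everywhere finiteness of an integrand whose penalization has finite integral. -/
theorem ae_eq_coe_of_lintegral_penalizedIntegrand_ne_top [MeasurableSpace X] [BorelSpace X]
    [SecondCountableTopology X] {p : ℝ} {f : T → X → EReal}
    (hf : Measurable (Function.uncurry f)) {k c : T → ℝ} (hk : Measurable k) (hc : Measurable c)
    (hgood : ∀ᵐ t ∂μ, ∀ v y : X,
      0 ≤ f t v + ((‖v - y‖ ^ p + k t * ‖y‖ + c t : ℝ) : EReal))
    {v : T → X} {y : X} (hv : Measurable v)
    (hfin : ∫⁻ t, penalizedIntegrand f p k c t (v t) y ∂μ ≠ ⊤) :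
    ∀ᵐ t ∂μ, f t (v t) = ((f t (v t)).toReal : EReal) ∧
      ∀ y', penalizedIntegrand f p k c t (v t) y' =
        ENNReal.ofReal ((f t (v t)).toReal + (‖v t - y'‖ ^ p + k t * ‖y'‖ + c t)) ∧
      0 ≤ (f t (v t)).toReal + (‖v t - y'‖ ^ p + k t * ‖y'‖ + c t) := by
  have hm : Measurable fun t => penalizedIntegrand f p k c t (v t) y :=
    (measurable_penalizedIntegrand hf hk hc).comp
      (measurable_id.prodMk (hv.prodMk measurable_const))
  filter_upwards [hgood, ae_lt_top hm hfin] with t ht hlt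
  have hb : f t (v t) ≠ ⊥ := ne_bot_of_zero_le_add_coe (ht (v t) y)
  have htop : f t (v t) ≠ ⊤ := by
    intro h
    have := coe_penalizedIntegrand (ht (v t) y)
    rw [h, EReal.top_add_coe, EReal.coe_ennreal_eq_top_iff] at this
    exact hlt.ne this
  have he := (EReal.coe_toReal htop hb).symm
  refine ⟨he, fun y' => ⟨?_, ?_⟩⟩
  · rw [penalizedIntegrand, he, EReal.toENNReal_coe_add_coe, EReal.toReal_coe]
  · have := ht (v t) y'
    rw [he, ← EReal.coe_add] at this
    exact_mod_cast this

/-- For fixed `v` the term `f(t, v(t)) + c(t)` is integrable and independent of `y'`. Its integral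
`B` splits off, and the dependence on `y'` is explicit. -/
theorem lintegral_penalizedIntegrand_add_eq [IsFiniteMeasure μ] [MeasurableSpace X] [BorelSpace X]
    [SecondCountableTopology X] {p : ℝ} (hp : 0 < p) {f : T → X → EReal}
    (hf : Measurable (Function.uncurry f)) {k c : T → ℝ} (hk : Measurable k) (hc : Measurable c)
    (hki : Integrable k μ)
    (hgood : ∀ᵐ t ∂μ, ∀ v y : X,
      0 ≤ f t v + ((‖v - y‖ ^ p + k t * ‖y‖ + c t : ℝ) : EReal))
    {v : T → X} {y : X} (hv : StronglyMeasurable v) (hvp : MemLp v (ENNReal.ofReal p) μ)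
    (hfin : ∫⁻ t, penalizedIntegrand f p k c t (v t) y ∂μ ≠ ⊤) (n : ℕ) :
    ∃ B : ℝ, ∀ y',
      0 ≤ B + (n + 1) * ∫ t, ‖v t - y'‖ ^ p ∂μ + (∫ t, k t ∂μ) * ‖y'‖ ∧
      ∫⁻ t, (penalizedIntegrand f p k c t (v t) y' + n * ‖v t - y'‖ₑ ^ p) ∂μ =
        ENNReal.ofReal (B + (n + 1) * ∫ t, ‖v t - y'‖ ^ p ∂μ + (∫ t, k t ∂μ) * ‖y'‖) := by
  have hae := ae_eq_coe_of_lintegral_penalizedIntegrand_ne_top hf hk hc hgood hv.measurable hfin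
  have hNi : ∀ y', Integrable (fun t => ‖v t - y'‖ ^ p) μ := fun y' => by
    simpa [ENNReal.toReal_ofReal hp.le] using
      (hvp.sub (memLp_const y')).integrable_norm_rpow (by simpa using hp) ENNReal.ofReal_ne_top
  have hφm : Measurable fun t => (f t (v t)).toReal :=
    (hf.comp (measurable_id.prodMk hv.measurable)).ereal_toReal
  have hψ : Integrable
      (fun t => (f t (v t)).toReal + (‖v t - y‖ ^ p + k t * ‖y‖ + c t)) μ := by
    rw [← lintegral_ofReal_ne_top_iff_integrable]
    · rwa [← lintegral_congr_ae (hae.mono fun t ht => (ht.2 y).1)]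
    · have := hv.measurable
      exact (by fun_prop : Measurable fun t =>
        (f t (v t)).toReal + (‖v t - y‖ ^ p + k t * ‖y‖ + c t)).aestronglyMeasurable
    · exact hae.mono fun t ht => (ht.2 y).2
  have hB : Integrable (fun t => (f t (v t)).toReal + c t) μ := by
    refine ((hψ.sub (hNi y)).sub (hki.mul_const ‖y‖)).congr (ae_of_all _ fun t => ?_)
    simp only [Pi.sub_apply]
    ring
  refine ⟨∫ t, ((f t (v t)).toReal + c t) ∂μ, fun y' => ?_⟩
  have hsum₁ : Integrable (fun t => ((f t (v t)).toReal + c t) + (n + 1) * ‖v t - y'‖ ^ p) μ :=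
    hB.add ((hNi y').const_mul _)
  have hsum : Integrable (fun t => ((f t (v t)).toReal + c t) + (n + 1) * ‖v t - y'‖ ^ p +
      k t * ‖y'‖) μ := hsum₁.add (hki.mul_const _)
  have hnn : ∀ᵐ t ∂μ, 0 ≤ ((f t (v t)).toReal + c t) + (n + 1) * ‖v t - y'‖ ^ p +
      k t * ‖y'‖ := by
    filter_upwards [hae] with t ht
    have h1 := (ht.2 y').2
    have h2 : 0 ≤ (n : ℝ) * ‖v t - y'‖ ^ p := by positivity
    linarith
  have hint : ∫ t, (((f t (v t)).toReal + c t) + (n + 1) * ‖v t - y'‖ ^ p + k t * ‖y'‖) ∂μ =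
      ∫ t, ((f t (v t)).toReal + c t) ∂μ + (n + 1) * ∫ t, ‖v t - y'‖ ^ p ∂μ +
        (∫ t, k t ∂μ) * ‖y'‖ := by
    rw [integral_add hsum₁ (hki.mul_const _),
      integral_add hB ((hNi y').const_mul _), integral_const_mul, integral_mul_const]
  rw [← hint]
  refine ⟨integral_nonneg_of_ae hnn, ?_⟩
  rw [ofReal_integral_eq_lintegral_ofReal hsum hnn]
  refine lintegral_congr_ae ?_
  filter_upwards [hae] with t ht
  rw [(ht.2 y').1]
  have e1 : (n : ℝ≥0∞) * ‖v t - y'‖ₑ ^ p = ENNReal.ofReal (n * ‖v t - y'‖ ^ p) := by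
    rw [ENNReal.ofReal_mul (Nat.cast_nonneg n), ENNReal.ofReal_natCast,
      ← ENNReal.ofReal_rpow_of_nonneg (norm_nonneg _) hp.le, ofReal_norm]
  rw [e1, ← ENNReal.ofReal_add (ht.2 y').2 (by positivity)]
  congr 1
  ring

variable [NormedSpace ℝ X]

/-- Stationarity in the finite-dimensional variable. -/
theorem abs_apply_integral_fderiv_add_le [IsFiniteMeasure μ] [CompleteSpace X]
    [MeasurableSpace X] [BorelSpace X] [SecondCountableTopology X]
    (hnorm : ContDiffOn ℝ 1 (fun u : X => ‖u‖) {0}ᶜ) {p : ℝ} (hp : 1 < p) {f : T → X → EReal}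
    (hf : Measurable (Function.uncurry f)) {k c : T → ℝ} (hk : Measurable k) (hc : Measurable c)
    (hki : Integrable k μ)
    (hgood : ∀ᵐ t ∂μ, ∀ v y : X,
      0 ≤ f t v + ((‖v - y‖ ^ p + k t * ‖y‖ + c t : ℝ) : EReal))
    {v : T → X} {y : X} (hv : StronglyMeasurable v) (hvp : MemLp v (ENNReal.ofReal p) μ)
    (hfin : ∫⁻ t, penalizedIntegrand f p k c t (v t) y ∂μ ≠ ⊤) {n : ℕ}
    {x' : StrongDual ℝ X} {C η r : ℝ} (hη : 0 ≤ η) {L : Submodule ℝ X}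
    (hθ : ∀ y' ∈ L, ‖y'‖ ≤ r → 0 ≤ C - (∫ t, k t ∂μ) * ‖y'‖ - x' y' + η * ‖y'‖)
    (hyL : y ∈ L) (hyr : ‖y‖ < r)
    (hmin : ∀ y' ∈ L, ‖y'‖ ≤ r →
      ∫⁻ t, (penalizedIntegrand f p k c t (v t) y + n * ‖v t - y‖ₑ ^ p) ∂μ +
        ENNReal.ofReal (C - (∫ t, k t ∂μ) * ‖y‖ - x' y + η * ‖y‖) ≤
      ∫⁻ t, (penalizedIntegrand f p k c t (v t) y' + n * ‖v t - y'‖ₑ ^ p) ∂μ +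
        ENNReal.ofReal (C - (∫ t, k t ∂μ) * ‖y'‖ - x' y' + η * ‖y'‖)) {u : X} (hu : u ∈ L) :
    |(n + 1 : ℝ) * (∫ t, fderiv ℝ (fun u : X => ‖u‖ ^ p) (v t - y) ∂μ) u + x' u| ≤ η * ‖u‖ := by
  obtain ⟨B, hB⟩ := lintegral_penalizedIntegrand_add_eq (zero_lt_one.trans hp) hf hk hc hki hgood
    hv hvp hfin n
  -- The term `κ‖y'‖` of the integral, `κ = ∫ k`, cancels against the one subtracted in `θ`. Only
  -- `η‖y'‖` remains nonsmooth, and it is kept outside `Γ`.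
  let Γ : X → ℝ := fun y' => (n + 1) * ∫ t, ‖v t - y'‖ ^ p ∂μ - x' y'
  have hΓle : ∀ y' ∈ L, ‖y'‖ ≤ r → Γ y + η * ‖y‖ ≤ Γ y' + η * ‖y'‖ := by
    intro y' hy' hy'r
    have h := hmin y' hy' hy'r
    rw [(hB y).2, (hB y').2, ← ENNReal.ofReal_add (hB y).1 (hθ y hyL hyr.le),
      ← ENNReal.ofReal_add (hB y').1 (hθ y' hy' hy'r),
      ENNReal.ofReal_le_ofReal_iff (add_nonneg (hB y').1 (hθ y' hy' hy'r))] at h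
    simp only [Γ]
    linarith
  have hΓ := ((hasFDerivAt_integral_norm_sub_rpow hnorm hp hv hvp y).const_mul (n + 1 : ℝ)).sub
    x'.hasFDerivAt
  have key : ∀ w ∈ L, -(η * ‖w‖) ≤
      -((n + 1 : ℝ) * (∫ t, fderiv ℝ (fun u : X => ‖u‖ ^ p) (v t - y) ∂μ) w + x' w) := by
    intro w hw
    have h1 : ∀ᶠ s in 𝓝[>] (0 : ℝ), Γ y ≤ Γ (y + s • w) + η * ‖w‖ * s := by
      have h2 : Tendsto (fun s : ℝ => ‖y + s • w‖) (𝓝[>] 0) (𝓝 ‖y‖) := by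
        have : Continuous fun s : ℝ => ‖y + s • w‖ := by fun_prop
        exact ((this.tendsto' 0 ‖y‖ (by simp)).mono_left nhdsWithin_le_nhds)
      filter_upwards [h2.eventually (gt_mem_nhds hyr), self_mem_nhdsWithin] with s hs (hs0 : 0 < s)
      have h3 := hΓle (y + s • w) (L.add_mem hyL (L.smul_mem s hw)) hs.le
      have h4 : ‖y + s • w‖ ≤ ‖y‖ + s * ‖w‖ := by
        refine (norm_add_le _ _).trans ?_
        rw [norm_smul, Real.norm_of_nonneg hs0.le]
      nlinarith
    have h5 := neg_le_apply_of_hasFDerivAt hΓ h1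
    rw [integral_neg] at h5
    refine h5.trans (le_of_eq ?_)
    simp only [sub_apply, smul_apply, neg_apply, smul_eq_mul]
    ring
  refine abs_le.2 ⟨?_, ?_⟩
  · have := key (-u) (L.neg_mem hu)
    rw [map_neg, map_neg, norm_neg] at this
    linarith
  · have := key u hu
    linarith

end Stationarity

/-! ### Near-optimal triples with small penalty and perturbation -/

section Approximation

open scoped NNReal ENNReal

variable {T X : Type*} [MeasurableSpace T] {μ : Measure T} [NormedAddCommGroup X]

/-- Minimizers of the penalized and perturbed functionals, with small penalty and perturbation. -/
theorem exists_perturbed_minimizer_near_zero [MeasurableSpace X] [BorelSpace X]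
    [SecondCountableTopology X] [CompleteSpace X] {p : ℝ} (hp : 1 < p) {h : T → X → X → ℝ≥0∞}
    (hm : ∀ y, Measurable fun z : T × X => h z.1 z.2 y)
    (hlsc : ∀ t, LowerSemicontinuous fun z : X × X => h t z.1 z.2) {θ : X → ℝ≥0∞}
    (hθ : Continuous θ) (hθt : ∀ y, θ y ≠ ⊤) {K : Set X} (hK : IsCompact K) (h0K : (0 : X) ∈ K)
    {ε : ℝ} (hε : 0 < ε) (hfin : ∫⁻ t, h t 0 0 ∂μ ≠ ⊤)
    (hgrowth : ∀ y ∈ K, ∫⁻ t, h t 0 0 ∂μ + θ 0 + ENNReal.ofReal (ε * ‖y‖) ≤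
      ∫⁻ t, h t y y ∂μ + θ y)
    {δ : ℕ → ℝ≥0} (hδ : ∀ i, 0 < δ i) {τ : ℝ≥0∞} (hτ : 0 < τ) :
    ∃ (n : ℕ) (z : ℕ → T → X) (v : T → X) (y : X), (∀ i, StronglyMeasurable (z i)) ∧
      StronglyMeasurable v ∧ MemLp v (ENNReal.ofReal p) μ ∧ y ∈ K ∧ ‖y‖ₑ ≤ τ ∧
      ((n + 1 : ℝ≥0∞) * ∫⁻ t, ‖v t - y‖ₑ ^ p ∂μ ≤ τ) ∧
      (∫⁻ t, ∑' i, (δ i : ℝ≥0∞) * ‖v t - z i t‖ₑ ^ p ∂μ ≤ τ) ∧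
      (∫⁻ t, (h t (v t) y - h t 0 0) ∂μ + ∫⁻ t, (h t 0 0 - h t (v t) y) ∂μ ≤ τ) ∧
      (∫⁻ t, (h t (v t) y + n * ‖v t - y‖ₑ ^ p) ∂μ +
        ∫⁻ t, ∑' i, (δ i : ℝ≥0∞) * ‖v t - z i t‖ₑ ^ p ∂μ ≠ ⊤) ∧
      ∀ w : T → X, StronglyMeasurable w → MemLp w (ENNReal.ofReal p) μ → ∀ y' ∈ K,
        ∫⁻ t, (h t (v t) y + n * ‖v t - y‖ₑ ^ p) ∂μ + θ y +
          ∫⁻ t, ∑' i, (δ i : ℝ≥0∞) * ‖v t - z i t‖ₑ ^ p ∂μ ≤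
        ∫⁻ t, (h t (w t) y' + n * ‖w t - y'‖ₑ ^ p) ∂μ + θ y' +
          ∫⁻ t, ∑' i, (δ i : ℝ≥0∞) * ‖w t - z i t‖ₑ ^ p ∂μ := by
  have hp0 : 0 < p := zero_lt_one.trans hp
  let e : ℕ → ℝ≥0∞ := fun n => ((n : ℝ≥0∞) + 1)⁻¹
  have he0 : ∀ n, 0 < e n := fun n => by simp [e]
  have het : ∀ n, e n ≤ 1 := fun n => ENNReal.inv_le_one.2 le_add_self
  have he : Tendsto e atTop (𝓝 0) := by
    have := (tendsto_add_atTop_iff_nat 1).2 ENNReal.tendsto_inv_nat_nhds_zero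
    simpa [e] using this
  have hzero : ∀ n : ℕ, ∫⁻ t, (h t 0 0 + n * ‖(0 : X) - 0‖ₑ ^ p) ∂μ = ∫⁻ t, h t 0 0 ∂μ := by
    simp [hp0]
  have hex := fun n : ℕ => exists_perturbed_minimizer (μ := μ) hp
    (H := fun t u y => h t u y + n * ‖u - y‖ₑ ^ p)
    (fun y => (hm y).add (((measurable_snd.sub_const y).enorm.pow_const p).const_mul _))
    (fun t => (hlsc t).add (Continuous.lowerSemicontinuous
      ((ENNReal.continuous_const_mul (ENNReal.natCast_ne_top n)).comp
        (ENNReal.continuous_rpow_const.comp (continuous_fst.sub continuous_snd).enorm))))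
    hθ.lowerSemicontinuous hK h0K (by rw [hzero]; simp [hfin, hθt])
    (he0 n) (ne_top_of_le_ne_top ENNReal.one_ne_top (het n)) hδ
  simp only [hzero] at hex
  choose z v y hz hv hvp hyK hmin hle hP using hex
  have hHeq : ∀ n : ℕ, ∫⁻ t, (h t (v n t) (y n) + n * ‖v n t - y n‖ₑ ^ p) ∂μ =
      ∫⁻ t, h t (v n t) (y n) ∂μ + n * ∫⁻ t, ‖v n t - y n‖ₑ ^ p ∂μ := by
    intro n
    have hmn : Measurable fun t => h t (v n t) (y n) :=
      (hm _).comp (measurable_id.prodMk (hv n).measurable)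
    rw [lintegral_add_left hmn,
      lintegral_const_mul' _ _ (ENNReal.natCast_ne_top n)]
  obtain ⟨φ, hφ, hy0, hpen, hdiff⟩ := exists_subseq_tendsto_of_penalized_le hp hm hlsc hθ hθt hK hε
    hfin hgrowth hv hyK he het (fun n => by
      rw [← hHeq]
      exact le_self_add.trans (hle n))
  -- From `n` to `n + 1`: for `n ≥ 1` the factor at most doubles.
  have hpen' : Tendsto (fun j => ((φ j : ℝ≥0∞) + 1) *
      ∫⁻ t, ‖v (φ j) t - y (φ j)‖ₑ ^ p ∂μ) atTop (𝓝 0) := by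
    have h2 := hpen.add hpen
    rw [add_zero] at h2
    refine tendsto_of_tendsto_of_tendsto_of_le_of_le' tendsto_const_nhds h2
      (Eventually.of_forall fun _ => zero_le) ?_
    filter_upwards [hφ.tendsto_atTop.eventually_ge_atTop 1] with j hj
    rw [add_mul]
    gcongr
    exact_mod_cast hj
  have hy0' : Tendsto (fun j => ‖y (φ j)‖ₑ) atTop (𝓝 0) := by
    simpa using hy0.enorm
  obtain ⟨j, h1, h2, h3, h4⟩ := ((hy0'.eventually (ge_mem_nhds hτ)).and
    ((hpen'.eventually (ge_mem_nhds hτ)).and ((hdiff.eventually (ge_mem_nhds hτ)).and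
      ((he.comp hφ.tendsto_atTop).eventually (ge_mem_nhds hτ))))).exists
  refine ⟨φ j, z (φ j), v (φ j), y (φ j), hz _, hv _, hvp _, hyK _, h1, h2, (hP _).trans h4, h3,
    ?_, hmin _⟩
  have hfin' : ∫⁻ t, h t 0 0 ∂μ + θ 0 + e (φ j) ≠ ⊤ := by
    simp [hfin, hθt, ne_top_of_le_ne_top ENNReal.one_ne_top (het (φ j))]
  refine ne_top_of_le_ne_top hfin' (le_trans ?_ (hle (φ j)))
  gcongr
  exact le_self_add

end Approximation

/-! ### Quantitative approximate subgradients -/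

section Approximation

open scoped NNReal ENNReal

variable {T X : Type*} [MeasurableSpace T] {μ : Measure T} [NormedAddCommGroup X]

theorem isCompact_submodule_inter_closedBall [NormedSpace ℝ X] (L : Submodule ℝ X)
    [FiniteDimensional ℝ L] (r : ℝ) : IsCompact {y : X | y ∈ L ∧ ‖y‖ ≤ r} := by
  have : ProperSpace L := FiniteDimensional.proper ℝ L
  convert (isCompact_closedBall (0 : L) r).image continuous_subtype_val using 1
  ext y
  simp [and_comm]

/-- Where finite, `f(t,v) - f(t,0)` is the difference of the penalized integrands minus `‖v-y‖^p +
k‖y‖`. This converts `L^1` closeness of the penalized integrands into conclusion (f). -/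
theorem lintegral_abs_sub_le_of_penalizedIntegrand [MeasurableSpace X] [BorelSpace X]
    [SecondCountableTopology X] {p : ℝ} (hp : 0 < p) {f : T → X → EReal}
    (hf : Measurable (Function.uncurry f)) {k c : T → ℝ} (hk : Measurable k) (hc : Measurable c)
    (hk0 : ∀ t, 0 ≤ k t) (hki : Integrable k μ)
    (hgood : ∀ᵐ t ∂μ, ∀ v y : X,
      0 ≤ f t v + ((‖v - y‖ ^ p + k t * ‖y‖ + c t : ℝ) : EReal))
    {v : T → X} {y : X} (hv : StronglyMeasurable v)
    (hfin : ∫⁻ t, penalizedIntegrand f p k c t (v t) y ∂μ ≠ ⊤)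
    (hfin0 : ∫⁻ t, penalizedIntegrand f p k c t 0 0 ∂μ ≠ ⊤) :
    ∫⁻ t, (f t (v t) - f t 0).abs ∂μ ≤
      ∫⁻ t, (penalizedIntegrand f p k c t (v t) y - penalizedIntegrand f p k c t 0 0) ∂μ +
      ∫⁻ t, (penalizedIntegrand f p k c t 0 0 - penalizedIntegrand f p k c t (v t) y) ∂μ +
      ∫⁻ t, ‖v t - y‖ₑ ^ p ∂μ + ENNReal.ofReal (∫ t, k t ∂μ) * ‖y‖ₑ := by
  have hm : ∀ {w : T → X} (y : X), Measurable w →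
      Measurable fun t => penalizedIntegrand f p k c t (w t) y := fun y hw =>
    (measurable_penalizedIntegrand hf hk hc).comp
      (measurable_id.prodMk (hw.prodMk measurable_const))
  have hm1 := hm y hv.measurable
  have hm0 := hm (w := fun _ => 0) 0 measurable_const
  have hm2 : Measurable fun t => ‖v t - y‖ₑ ^ p :=
    (hv.sub stronglyMeasurable_const).enorm.pow_const p
  have hm3 : Measurable fun t =>
      penalizedIntegrand f p k c t (v t) y - penalizedIntegrand f p k c t 0 0 := hm1.sub hm0
  have hm4 : Measurable fun t =>
      (penalizedIntegrand f p k c t (v t) y - penalizedIntegrand f p k c t 0 0) +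
      (penalizedIntegrand f p k c t 0 0 - penalizedIntegrand f p k c t (v t) y) :=
    hm3.add (hm0.sub hm1)
  have hm5 : Measurable fun t =>
      (penalizedIntegrand f p k c t (v t) y - penalizedIntegrand f p k c t 0 0) +
      (penalizedIntegrand f p k c t 0 0 - penalizedIntegrand f p k c t (v t) y) +
      ‖v t - y‖ₑ ^ p := hm4.add hm2
  rw [ofReal_integral_eq_lintegral_ofReal hki (ae_of_all _ hk0),
    ← lintegral_mul_const' _ _ (enorm_ne_top), ← lintegral_add_left hm3,
    ← lintegral_add_left hm4, ← lintegral_add_left hm5]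
  refine lintegral_mono_ae ?_
  filter_upwards [ae_eq_coe_of_lintegral_penalizedIntegrand_ne_top hf hk hc hgood hv.measurable hfin,
    ae_eq_coe_of_lintegral_penalizedIntegrand_ne_top hf hk hc hgood
      (measurable_const (a := (0 : X))) hfin0] with t ht ht0
  obtain ⟨h1, h2⟩ := ht
  obtain ⟨h3, h4⟩ := ht0
  have h2' := h2 y
  have h4' := h4 0
  rw [h1, h3, h2'.1, h4'.1, ← EReal.coe_sub, EReal.abs_def, ← ofReal_norm,
    ENNReal.ofReal_rpow_of_nonneg (norm_nonneg _) hp.le, ← ofReal_norm y,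
    ← ENNReal.ofReal_mul (hk0 t), ← ENNReal.ofReal_sub _ h4'.2, ← ENNReal.ofReal_sub _ h2'.2]
  generalize (f t (v t)).toReal = a at *
  generalize (f t 0).toReal = b at *
  simp only [sub_self, norm_zero, Real.zero_rpow hp.ne', mul_zero, zero_add]
  have hN : 0 ≤ ‖v t - y‖ ^ p := by positivity
  have hky : 0 ≤ k t * ‖y‖ := mul_nonneg (hk0 t) (norm_nonneg _)
  set N := ‖v t - y‖ ^ p
  set s := k t * ‖y‖
  have h5 : |a - b| ≤ max (a + (N + s + c t) - (b + c t)) 0 +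
      max (b + c t - (a + (N + s + c t))) 0 + N + s := by
    rcases abs_cases (a - b) with ⟨h, -⟩ | ⟨h, -⟩ <;> rw [h]
    · have e1 := le_max_left (a + (N + s + c t) - (b + c t)) 0
      have e2 := le_max_right (b + c t - (a + (N + s + c t))) 0
      linarith
    · have e1 := le_max_right (a + (N + s + c t) - (b + c t)) 0
      have e2 := le_max_left (b + c t - (a + (N + s + c t))) 0
      linarith
  refine (ENNReal.ofReal_le_ofReal h5).trans (le_of_eq ?_)
  rw [ENNReal.ofReal_add (by positivity) hky, ENNReal.ofReal_add (by positivity) hN,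
    ENNReal.ofReal_add (by positivity) (by positivity), ENNReal.ofReal_max, ENNReal.ofReal_max]
  simp

variable [NormedSpace ℝ X]

/-- Approximate subgradients of an integral functional, with quantitative bounds. -/
theorem exists_approximate_subgradient [IsFiniteMeasure μ] [CompleteSpace X]
    [MeasurableSpace X] [BorelSpace X] [SecondCountableTopology X]
    (hnorm : ContDiffOn ℝ 1 (fun u : X => ‖u‖) {0}ᶜ) {p q : ℝ} (hpq : p.HolderConjugate q)
    {f : T → X → EReal} (hf : Measurable (Function.uncurry f))
    (hlsc : ∀ t, LowerSemicontinuous (f t)) {k c : T → ℝ} (hk : Measurable k) (hc : Measurable c)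
    (hk0 : ∀ t, 0 ≤ k t) (hki : Integrable k μ)
    (hgood : ∀ᵐ t ∂μ, ∀ v y : X,
      0 ≤ f t v + ((‖v - y‖ ^ p + k t * ‖y‖ + c t : ℝ) : EReal))
    (hfin : ∫⁻ t, penalizedIntegrand f p k c t 0 0 ∂μ ≠ ⊤)
    {x' : StrongDual ℝ X} {η r : ℝ} (hη : 0 < η) (hr : 0 < r)
    (hgrow : ∀ y, ‖y‖ ≤ r → ∫⁻ t, penalizedIntegrand f p k c t y y ∂μ ≠ ⊤ →
      (∫⁻ t, penalizedIntegrand f p k c t 0 0 ∂μ).toReal + (∫ t, k t ∂μ) * ‖y‖ + x' y ≤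
        (∫⁻ t, penalizedIntegrand f p k c t y y ∂μ).toReal + η / 2 * ‖y‖)
    (L : Submodule ℝ X) [FiniteDimensional ℝ L] {τ : ℝ≥0∞} (hτ : 0 < τ)
    (hτr : τ < ENNReal.ofReal r) :
    ∃ (y : X) (v : T → X) (w : T → StrongDual ℝ X), y ∈ L ∧ StronglyMeasurable v ∧
      MemLp v (ENNReal.ofReal p) μ ∧ MemLp w (ENNReal.ofReal q) μ ∧
      (∀ᵐ t ∂μ, w t ∈ frechetSubdiff (f t) (v t)) ∧ ‖y‖ₑ ≤ τ ∧
      eLpNorm (fun t => v t - y) (ENNReal.ofReal p) μ ≤ τ ^ (1 / p) ∧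
      eLpNorm w (ENNReal.ofReal q) μ * eLpNorm (fun t => v t - y) (ENNReal.ofReal p) μ ≤
        2 * ENNReal.ofReal p * τ ∧
      (∀ u ∈ L, |(∫ t, w t ∂μ) u - x' u| ≤
        (η + (ENNReal.ofReal p * τ ^ (1 / q) * μ univ ^ (1 - 1 / q)).toReal) * ‖u‖) ∧
      ∫⁻ t, (f t (v t) - f t 0).abs ∂μ ≤ 2 * τ + ENNReal.ofReal (∫ t, k t ∂μ) * τ := by
  have hp := hpq.lt
  have hp0 := hpq.pos
  have hq0 := hpq.symm.pos
  have hτt : τ ≠ ⊤ := hτr.ne_top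
  obtain ⟨δ, hδ, hδ1⟩ := ENNReal.exists_pos_sum_of_countable one_ne_zero ℕ
  have hδs : Summable δ := ENNReal.tsum_coe_ne_top_iff_summable.1 hδ1.ne_top
  set κ := ∫ t, k t ∂μ with hκ
  have hκ0 : 0 ≤ κ := integral_nonneg hk0
  -- Large enough for `ϑ` to be nonnegative on the ball of radius `r`, so that passing to `ENNReal`
  -- loses nothing there.
  let C : ℝ := (κ + ‖x'‖) * r
  -- `-κ‖y‖` undoes the term `k‖y‖` of the integrand. Of `η‖y‖`, half absorbs the error in `hgrow`
  -- and half survives as strict growth.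
  let ϑ : X → ℝ := fun y => C - κ * ‖y‖ - x' y + η * ‖y‖
  have hϑ0 : ∀ y, ‖y‖ ≤ r → 0 ≤ ϑ y := by
    intro y hy
    have h1 : κ * ‖y‖ ≤ κ * r := by gcongr
    have h2 : x' y ≤ ‖x'‖ * r := (Real.le_norm_self _).trans
      ((x'.le_opNorm y).trans (by gcongr))
    have h3 : 0 ≤ η * ‖y‖ := by positivity
    simp only [ϑ, C]
    linarith
  have hϑc : Continuous ϑ := by fun_prop
  set K : Set X := {y : X | y ∈ L ∧ ‖y‖ ≤ r} with hKdef
  have hgrowth : ∀ y ∈ K, ∫⁻ t, penalizedIntegrand f p k c t 0 0 ∂μ + ENNReal.ofReal (ϑ 0) +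
      ENNReal.ofReal (η / 2 * ‖y‖) ≤
      ∫⁻ t, penalizedIntegrand f p k c t y y ∂μ + ENNReal.ofReal (ϑ y) := by
    intro y hy
    by_cases hyt : ∫⁻ t, penalizedIntegrand f p k c t y y ∂μ = ⊤
    · simp [hyt]
    have h1 := hgrow y hy.2 hyt
    rw [← ENNReal.ofReal_toReal hfin, ← ENNReal.ofReal_toReal hyt,
      ← ENNReal.ofReal_add ENNReal.toReal_nonneg (hϑ0 0 (by simpa using hr.le)),
      ← ENNReal.ofReal_add (add_nonneg ENNReal.toReal_nonneg (hϑ0 0 (by simpa using hr.le)))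
        (by positivity), ← ENNReal.ofReal_add ENNReal.toReal_nonneg (hϑ0 y hy.2)]
    refine ENNReal.ofReal_le_ofReal ?_
    simp only [ϑ, norm_zero, map_zero, mul_zero, sub_zero, add_zero]
    linarith
  have hm : ∀ y, Measurable fun z : T × X => penalizedIntegrand f p k c z.1 z.2 y := fun y =>
    (measurable_penalizedIntegrand hf hk hc).comp
      (measurable_fst.prodMk (measurable_snd.prodMk measurable_const))
  obtain ⟨n, z, v, y, hz, hv, hvp, hyK, hyτ, hpen, hP, hdiff, hfinH, hmin⟩ :=
    exists_perturbed_minimizer_near_zero (μ := μ) hp hm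
      (fun t => lowerSemicontinuous_penalizedIntegrand (hlsc t) hp0.le k c)
      (θ := fun y => ENNReal.ofReal (ϑ y)) (ENNReal.continuous_ofReal.comp hϑc)
      (fun _ => ENNReal.ofReal_ne_top) (isCompact_submodule_inter_closedBall L r)
      ⟨L.zero_mem, by simpa using hr.le⟩ (half_pos hη) hfin hgrowth hδ hτ
  have hPfin : ∫⁻ t, ∑' i, (δ i : ℝ≥0∞) * ‖v t - z i t‖ₑ ^ p ∂μ ≠ ⊤ :=
    ne_top_of_le_ne_top hτt hP
  have hhfin : ∫⁻ t, penalizedIntegrand f p k c t (v t) y ∂μ ≠ ⊤ :=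
    ne_top_of_le_ne_top (ENNReal.add_ne_top.1 hfinH).1 (lintegral_mono fun t => le_self_add)
  have hpenτ : ∫⁻ t, ‖v t - y‖ₑ ^ p ∂μ ≤ τ :=
    (le_mul_of_one_le_left zero_le le_add_self).trans hpen
  have hyr : ‖y‖ < r := by
    rw [← ENNReal.ofReal_lt_ofReal_iff hr, ofReal_norm]
    exact hyτ.trans_lt hτr
  let D₁ : T → StrongDual ℝ X := fun t => fderiv ℝ (fun u : X => ‖u‖ ^ p) (v t - y)
  let D₂ : T → StrongDual ℝ X := fun t =>
    ∑' i, (δ i : ℝ) • fderiv ℝ (fun u : X => ‖u‖ ^ p) (v t - z i t)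
  have hD₁ : eLpNorm D₁ (ENNReal.ofReal q) μ ≤
      ENNReal.ofReal p * (∫⁻ t, ‖v t - y‖ₑ ^ p ∂μ) ^ (1 / q) :=
    eLpNorm_le_of_enorm_le_rpow hq0 fun t => enorm_fderiv_norm_rpow_le_rpow_one_div hnorm hpq _
  have hD₂ : eLpNorm D₂ (ENNReal.ofReal q) μ ≤ ENNReal.ofReal p * τ ^ (1 / q) := by
    refine (eLpNorm_le_of_enorm_le_rpow
      (P := fun t => ∑' i, (δ i : ℝ≥0∞) * ‖v t - z i t‖ₑ ^ p) hq0 fun t => ?_).trans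
      (by gcongr)
    refine le_trans ?_ (tsum_enorm_smul_fderiv_norm_rpow_le hnorm hpq hδ1.le
      (y := fun i => v t - z i t))
    exact enorm_tsum_le_tsum_enorm (ε := StrongDual ℝ X)
  have hD₁p : MemLp D₁ (ENNReal.ofReal q) μ := by
    refine ⟨((continuous_fderiv_norm_rpow_of_contDiffOn hnorm hp).comp_stronglyMeasurable
      (hv.sub stronglyMeasurable_const)).aestronglyMeasurable, hD₁.trans_lt ?_⟩
    exact ENNReal.mul_lt_top ENNReal.ofReal_lt_top (ENNReal.rpow_lt_top_of_nonneg (by positivity)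
      (ne_top_of_le_ne_top hτt hpenτ))
  have hD₂p : MemLp D₂ (ENNReal.ofReal q) μ := by
    refine ⟨aestronglyMeasurable_tsum_smul_fderiv_norm_rpow hnorm hpq hδ1.le
      (fun i => hv.sub (hz i)) hPfin, hD₂.trans_lt ?_⟩
    exact ENNReal.mul_lt_top ENNReal.ofReal_lt_top
      (ENNReal.rpow_lt_top_of_nonneg (by positivity) hτt)
  have hq1 : 1 ≤ ENNReal.ofReal q := by
    simpa using ENNReal.ofReal_le_ofReal hpq.symm.lt.le
  have hD₁i : Integrable D₁ μ := hD₁p.integrable hq1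
  have hD₂i : Integrable D₂ μ := hD₂p.integrable hq1
  have hvy : eLpNorm (fun t => v t - y) (ENNReal.ofReal p) μ =
      (∫⁻ t, ‖v t - y‖ₑ ^ p ∂μ) ^ (1 / p) := by
    rw [← eLpNorm_ofReal_rpow hp0, ← ENNReal.rpow_mul, mul_one_div_cancel hp0.ne',
      ENNReal.rpow_one]
  refine ⟨y, v, fun t => -((n + 1 : ℝ) • D₁ t + D₂ t), hyK.1, hv, hvp,
    ((hD₁p.const_smul (n + 1 : ℝ)).add hD₂p).neg, ?_, hyτ, ?_, ?_, ?_, ?_⟩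
  · refine ae_mem_frechetSubdiff_of_minimizer hnorm hp hδs hf hk hc hgood hv hvp hz hfinH
      fun w hw hwp => ?_
    -- With `y` frozen the terms `ϑ y` cancel.
    have h1 := hmin w hw hwp y hyK
    rw [add_right_comm, add_right_comm _ (ENNReal.ofReal (ϑ y))] at h1
    exact (ENNReal.add_le_add_iff_right ENNReal.ofReal_ne_top).1 h1
  · rw [hvy]
    gcongr
  · have h1 : eLpNorm (fun t => -((n + 1 : ℝ) • D₁ t + D₂ t)) (ENNReal.ofReal q) μ ≤
        (n + 1) * (ENNReal.ofReal p * (∫⁻ t, ‖v t - y‖ₑ ^ p ∂μ) ^ (1 / q)) +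
          ENNReal.ofReal p * τ ^ (1 / q) := by
      have h2 := eLpNorm_add_le (hD₁p.const_smul (n + 1 : ℝ)).1 hD₂p.1 hq1
      have h3 : eLpNorm (fun t => -((n + 1 : ℝ) • D₁ t + D₂ t)) (ENNReal.ofReal q) μ =
          eLpNorm (((n + 1 : ℝ) • D₁) + D₂) (ENNReal.ofReal q) μ := eLpNorm_neg _ _ _
      rw [h3]
      refine h2.trans (add_le_add ?_ hD₂)
      rw [eLpNorm_const_smul]
      have h4 : ‖(n + 1 : ℝ)‖ₑ = n + 1 := by
        rw [← ofReal_norm, Real.norm_of_nonneg (by positivity),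
          ENNReal.ofReal_add (by positivity) zero_le_one, ENNReal.ofReal_natCast,
          ENNReal.ofReal_one]
      rw [h4]
      gcongr
    set A := ∫⁻ t, ‖v t - y‖ₑ ^ p ∂μ with hA
    -- The exponents add up to `1`, so the large factor `n + 1` multiplies exactly `A`, and `(n + 1)
    -- * A ≤ τ`.
    have e2 : 1 / q + 1 / p = 1 := by
      simpa [add_comm] using hpq.inv_add_inv_eq_one
    have h5 : ∀ a : ℝ≥0∞, a ^ (1 / q) * a ^ (1 / p) = a := fun a => by
      rw [← ENNReal.rpow_add_of_nonneg _ _ (by positivity) (by positivity), e2, ENNReal.rpow_one]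
    rw [hvy]
    calc _ ≤ ((n + 1) * (ENNReal.ofReal p * A ^ (1 / q)) + ENNReal.ofReal p * τ ^ (1 / q)) *
          A ^ (1 / p) := by gcongr
      _ = ENNReal.ofReal p * ((n + 1) * (A ^ (1 / q) * A ^ (1 / p))) +
          ENNReal.ofReal p * (τ ^ (1 / q) * A ^ (1 / p)) := by ring
      _ ≤ ENNReal.ofReal p * ((n + 1) * A) + ENNReal.ofReal p * (τ ^ (1 / q) * τ ^ (1 / p)) := by
          rw [h5 A]
          gcongr
      _ ≤ ENNReal.ofReal p * τ + ENNReal.ofReal p * τ := by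
          rw [h5 τ]
          gcongr
      _ = _ := by ring
  · intro u hu
    have h1 := abs_apply_integral_fderiv_add_le hnorm hp hf hk hc hki hgood hv hvp hhfin (n := n)
      (C := C) hη.le (fun y' _ hy' => hϑ0 y' hy') hyK.1 hyr (fun y' hy'L hy'r => ?_) hu
    · have h2 : ‖∫ t, D₂ t ∂μ‖ ≤
          (ENNReal.ofReal p * τ ^ (1 / q) * μ univ ^ (1 - 1 / q)).toReal := by
        have h3 : ‖∫ t, D₂ t ∂μ‖ₑ ≤ ENNReal.ofReal p * τ ^ (1 / q) * μ univ ^ (1 - 1 / q) := by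
          refine (enorm_integral_le_lintegral_enorm _).trans ?_
          rw [← eLpNorm_one_eq_lintegral_enorm]
          refine (eLpNorm_le_eLpNorm_mul_rpow_measure_univ hq1 hD₂p.1).trans ?_
          rw [ENNReal.toReal_one, ENNReal.toReal_ofReal hq0.le, div_one]
          gcongr
        rw [← toReal_enorm]
        refine ENNReal.toReal_mono ?_ h3
        refine ENNReal.mul_ne_top (ENNReal.mul_ne_top ENNReal.ofReal_ne_top
          (ENNReal.rpow_ne_top_of_nonneg (by positivity) hτt))
          (ENNReal.rpow_ne_top_of_nonneg ?_ (measure_ne_top _ _))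
        rw [sub_nonneg, div_le_one hq0]
        exact hpq.symm.lt.le
      have h4 : ∫ t, -((n + 1 : ℝ) • D₁ t + D₂ t) ∂μ =
          -((n + 1 : ℝ) • (∫ t, D₁ t ∂μ) + ∫ t, D₂ t ∂μ) := by
        have h6 : Integrable (fun t => (n + 1 : ℝ) • D₁ t) μ := hD₁i.smul (n + 1 : ℝ)
        rw [integral_neg, integral_add h6 hD₂i, integral_smul]
      rw [h4]
      have h5 : (-((n + 1 : ℝ) • (∫ t, D₁ t ∂μ) + ∫ t, D₂ t ∂μ)) u - x' u =
          -((n + 1 : ℝ) * (∫ t, D₁ t ∂μ) u + x' u) - (∫ t, D₂ t ∂μ) u := by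
        simp only [neg_apply, add_apply, smul_apply, smul_eq_mul]
        ring
      rw [h5, add_mul η]
      refine (abs_sub _ _).trans ?_
      rw [abs_neg]
      refine add_le_add h1 ?_
      exact ((∫ t, D₂ t ∂μ).le_opNorm u).trans (by gcongr)
    · exact (ENNReal.add_le_add_iff_right hPfin).1 (hmin v hv hvp y' ⟨hy'L, hy'r⟩)
  · refine (lintegral_abs_sub_le_of_penalizedIntegrand hp0 hf hk hc hk0 hki hgood hv hhfin
      hfin).trans ?_
    rw [two_mul]
    gcongr

end Approximation

/-! ### Reduction to nonnegative integrands, weak-star seminorms and Hölder bounds -/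

section Reduction

open scoped NNReal ENNReal

variable {T X : Type*} [MeasurableSpace T] {μ : Measure T} [NormedAddCommGroup X]

theorem EReal.toENNReal_add_coe_le (a : EReal) (b : ℝ) :
    (a + (b : EReal)).toENNReal ≤ a.toENNReal + ENNReal.ofReal b := by
  refine (EReal.toENNReal_add_le).trans (add_le_add le_rfl (le_of_eq ?_))
  rw [EReal.toENNReal_of_ne_top (EReal.coe_ne_top b), EReal.toReal_coe]

/-- The extended integral of a function bounded below by an integrable one. -/
theorem extIntegral_eq_of_nonneg_add {φ : T → EReal} (hφ : Measurable φ) {s : T → ℝ}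
    (hs : Integrable s μ) (h : ∀ᵐ t ∂μ, 0 ≤ φ t + (s t : EReal)) :
    (∫⁻ t, (φ t + (s t : EReal)).toENNReal ∂μ = ⊤ → extIntegral μ φ = ⊤) ∧
    (∫⁻ t, (φ t + (s t : EReal)).toENNReal ∂μ ≠ ⊤ → extIntegral μ φ =
      (((∫⁻ t, (φ t + (s t : EReal)).toENNReal ∂μ).toReal - ∫ t, s t ∂μ : ℝ) : EReal)) := by
  have hsp : ∫⁻ t, ENNReal.ofReal (s t) ∂μ ≠ ⊤ := hs.lintegral_lt_top.ne
  have hsn : ∫⁻ t, ENNReal.ofReal (-s t) ∂μ ≠ ⊤ := hs.neg.lintegral_lt_top.ne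
  have hsm : AEMeasurable (fun t => ENNReal.ofReal (-s t)) μ :=
    hs.1.aemeasurable.neg.ennreal_ofReal
  -- Adding an integrable function cannot change whether the positive part has infinite integral.
  have hiff : ∫⁻ t, (φ t).toENNReal ∂μ = ⊤ ↔ ∫⁻ t, (φ t + (s t : EReal)).toENNReal ∂μ = ⊤ := by
    constructor
    · intro htop
      by_contra hne
      refine (ENNReal.add_ne_top.2 ⟨hne, hsn⟩) (top_le_iff.1 ?_)
      rw [← htop, ← lintegral_add_right' _ hsm]
      refine lintegral_mono fun t => ?_
      have := EReal.toENNReal_add_coe_le (φ t + (s t : EReal)) (-s t)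
      rwa [add_assoc, ← EReal.coe_add, add_neg_cancel, EReal.coe_zero, add_zero] at this
    · intro htop
      by_contra hne
      refine (ENNReal.add_ne_top.2 ⟨hne, hsp⟩) (top_le_iff.1 ?_)
      rw [← htop, ← lintegral_add_right' _ hs.1.aemeasurable.ennreal_ofReal]
      exact lintegral_mono fun t => EReal.toENNReal_add_coe_le _ _
  refine ⟨fun htop => by rw [extIntegral, if_pos (hiff.2 htop)], fun hne => ?_⟩
  rw [extIntegral, if_neg (fun h => hne (hiff.1 h))]
  have hm : AEMeasurable (fun t => (φ t + (s t : EReal)).toENNReal) μ :=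
    (EReal.continuous_add_coe.measurable.comp_aemeasurable
      (hφ.aemeasurable.prodMk hs.1.aemeasurable)).ereal_toENNReal
  have hreal : ∀ᵐ t ∂μ, φ t = ((φ t).toReal : EReal) ∧ 0 ≤ (φ t).toReal + s t ∧
      (φ t + (s t : EReal)).toENNReal = ENNReal.ofReal ((φ t).toReal + s t) := by
    filter_upwards [h, ae_lt_top' hm hne] with t ht hlt
    have hb : φ t ≠ ⊥ := ne_bot_of_zero_le_add_coe ht
    have htop : φ t ≠ ⊤ := by
      intro h
      rw [h, EReal.top_add_coe] at hlt
      simp at hlt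
    have he := (EReal.coe_toReal htop hb).symm
    refine ⟨he, ?_, ?_⟩
    · rw [he, ← EReal.coe_add] at ht
      exact_mod_cast ht
    · rw [he, EReal.toENNReal_coe_add_coe, EReal.toReal_coe]
  have hψ : Integrable (fun t => (φ t).toReal + s t) μ := by
    have h1 : AEMeasurable (fun t => (φ t).toReal + s t) μ :=
      hφ.ereal_toReal.aemeasurable.add hs.1.aemeasurable
    rw [← lintegral_ofReal_ne_top_iff_integrable h1.aestronglyMeasurable
      (hreal.mono fun t ht => ht.2.1)]
    rwa [← lintegral_congr_ae (hreal.mono fun t ht => ht.2.2)]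
  have hF : Integrable (fun t => (φ t).toReal) μ := by
    refine (hψ.sub hs).congr (ae_of_all _ fun t => ?_)
    simp
  have e1 : ∫⁻ t, (φ t).toENNReal ∂μ = ∫⁻ t, ENNReal.ofReal (φ t).toReal ∂μ := by
    refine lintegral_congr_ae (hreal.mono fun t ht => ?_)
    beta_reduce
    rw [ht.1, EReal.toENNReal_of_ne_top (EReal.coe_ne_top _), EReal.toReal_coe]
  have e2 : ∫⁻ t, (-φ t).toENNReal ∂μ = ∫⁻ t, ENNReal.ofReal (-(φ t).toReal) ∂μ := by
    refine lintegral_congr_ae (hreal.mono fun t ht => ?_)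
    beta_reduce
    rw [ht.1, ← EReal.coe_neg, EReal.toENNReal_of_ne_top (EReal.coe_ne_top _), EReal.toReal_coe,
      EReal.toReal_coe]
  have e3 : ∫⁻ t, (φ t + (s t : EReal)).toENNReal ∂μ =
      ENNReal.ofReal (∫ t, ((φ t).toReal + s t) ∂μ) := by
    rw [ofReal_integral_eq_lintegral_ofReal hψ (hreal.mono fun t ht => ht.2.1)]
    exact lintegral_congr_ae (hreal.mono fun t ht => ht.2.2)
  have hFn : ∫⁻ t, ENNReal.ofReal (-(φ t).toReal) ∂μ ≠ ⊤ := hF.neg.lintegral_lt_top.ne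
  rw [e1, e2, e3, ENNReal.toReal_ofReal (integral_nonneg_of_ae (hreal.mono fun t ht => ht.2.1)),
    integral_add hF hs, add_sub_cancel_right,
    integral_eq_lintegral_pos_part_sub_lintegral_neg_part hF, EReal.coe_sub,
    EReal.coe_ennreal_toReal hF.lintegral_lt_top.ne,
    EReal.coe_ennreal_toReal hFn]

/-- The weak-star topology is generated by the seminorms `|A u|`, so finitely many of them control
`ρ`. -/
theorem Seminorm.exists_finset_bound_of_continuous_weakDual [NormedSpace ℝ X]
    (ρ : Seminorm ℝ (WeakDual ℝ X)) (hρ : Continuous ρ) :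
    ∃ (s : Finset X) (C : ℝ), 0 ≤ C ∧ ∀ (A : StrongDual ℝ X) (e : ℝ), 0 ≤ e →
      (∀ u ∈ s, |A u| ≤ e) → ρ (StrongDual.toWeakDual A) ≤ C * e := by
  obtain ⟨s, C, -, hC⟩ := Seminorm.bound_of_continuous
    (LinearMap.weakBilin_withSeminorms (topDualPairing ℝ X)) ρ hρ
  refine ⟨s, C, C.2, fun A e he h => (hC _).trans ?_⟩
  have h1 : s.sup (topDualPairing ℝ X).toSeminormFamily A ≤ e :=
    Seminorm.finset_sup_apply_le he fun u hu => h u hu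
  exact mul_le_mul_of_nonneg_left h1 C.2

/-- An `L^q` modulus for the Lipschitz constants of a measurable family of `C^1` functions. -/
theorem exists_measurable_lipschitz_bound [NormedSpace ℝ X] {q : ℝ} (hq : 1 < q) {g : T → X → ℝ}
    (hgC1 : ∀ t, ContDiff ℝ 1 (g t))
    (hgrad : MemLp (fun t => ⨆ u : X, ‖fderiv ℝ (g t) u‖ₑ) (ENNReal.ofReal q) μ) :
    ∃ k : T → ℝ, Measurable k ∧ (∀ t, 0 ≤ k t) ∧ MemLp k (ENNReal.ofReal q) μ ∧
      ∀ᵐ t ∂μ, ∀ u w, |g t u - g t w| ≤ k t * ‖u - w‖ := by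
  have hq0 : 0 < q := zero_lt_one.trans hq
  set G : T → ℝ≥0∞ := fun t => ⨆ u : X, ‖fderiv ℝ (g t) u‖ₑ with hG
  have hGm : AEMeasurable G μ := hgrad.1.aemeasurable
  have hGt : ∀ᵐ t ∂μ, G t < ⊤ := by
    have h1 := lintegral_rpow_enorm_lt_top_of_eLpNorm_lt_top (by simpa using hq0)
      ENNReal.ofReal_ne_top hgrad.2
    rw [ENNReal.toReal_ofReal hq0.le] at h1
    simp only [enorm_eq_self] at h1
    filter_upwards [ae_lt_top' (hGm.pow_const q) h1.ne] with t ht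
    exact (ENNReal.rpow_lt_top_iff_of_pos hq0).1 ht
  refine ⟨fun t => (hGm.mk G t).toReal, hGm.measurable_mk.ennreal_toReal,
    fun t => ENNReal.toReal_nonneg, ?_, ?_⟩
  · refine ⟨hGm.measurable_mk.ennreal_toReal.aestronglyMeasurable, ?_⟩
    refine lt_of_eq_of_lt (eLpNorm_congr_enorm_ae ?_) hgrad.2
    filter_upwards [hGm.ae_eq_mk, hGt] with t ht hlt
    rw [← ht, enorm_eq_self, ← ofReal_norm, Real.norm_of_nonneg ENNReal.toReal_nonneg,
      ENNReal.ofReal_toReal hlt.ne]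
  · filter_upwards [hGm.ae_eq_mk, hGt] with t ht hlt u w
    rw [← ht]
    refine Convex.norm_image_sub_le_of_norm_fderiv_le (𝕜 := ℝ) (s := univ)
      (fun z _ => (hgC1 t).differentiable one_ne_zero z) (fun z _ => ?_) convex_univ
      (mem_univ w) (mem_univ u)
    rw [← toReal_enorm]
    exact ENNReal.toReal_mono hlt.ne (le_iSup (fun u : X => ‖fderiv ℝ (g t) u‖ₑ) z)

/-- Young's inequality absorbs `k‖v-y‖` into `‖v-y‖^p + k^q`, and `k‖y‖` pays for the rest of
`k‖v‖`. This dictates the form of the penalized integrand. -/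
theorem zero_le_add_coe_of_lipschitz {p q : ℝ} (hpq : p.HolderConjugate q) {a : EReal}
    {b k : ℝ} (hk : 0 ≤ k) {v y : X} (h : ((b - k * ‖v‖ : ℝ) : EReal) ≤ a) :
    0 ≤ a + ((‖v - y‖ ^ p + k * ‖y‖ + (k ^ q - b) : ℝ) : EReal) := by
  refine le_trans ?_ (add_le_add_left h _)
  rw [← EReal.coe_add]
  have h1 : ‖v‖ ≤ ‖v - y‖ + ‖y‖ := by simpa using norm_add_le (v - y) y
  have h2 : k * ‖v‖ ≤ k * ‖v - y‖ + k * ‖y‖ := by nlinarith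
  have h3 := Real.young_inequality_of_nonneg (norm_nonneg (v - y)) hk hpq
  have h4 : ‖v - y‖ ^ p / p ≤ ‖v - y‖ ^ p := div_le_self (by positivity) hpq.lt.le
  have h5 : k ^ q / q ≤ k ^ q := div_le_self (by positivity) hpq.symm.lt.le
  have h6 : 0 ≤ b - k * ‖v‖ + (‖v - y‖ ^ p + k * ‖y‖ + (k ^ q - b)) := by nlinarith
  exact_mod_cast h6

theorem enorm_integral_apply_le [NormedSpace ℝ X] {p q : ℝ} (hpq : p.HolderConjugate q)
    {w : T → StrongDual ℝ X} {u : T → X} (hw : MemLp w (ENNReal.ofReal q) μ)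
    (hu : MemLp u (ENNReal.ofReal p) μ) :
    Integrable (fun t => w t (u t)) μ ∧
      ‖∫ t, w t (u t) ∂μ‖ₑ ≤ eLpNorm w (ENNReal.ofReal q) μ * eLpNorm u (ENNReal.ofReal p) μ := by
  have hp0 := hpq.pos
  have hq0 := hpq.symm.pos
  have hle : ∫⁻ t, ‖w t (u t)‖ₑ ∂μ ≤
      eLpNorm w (ENNReal.ofReal q) μ * eLpNorm u (ENNReal.ofReal p) μ := by
    calc ∫⁻ t, ‖w t (u t)‖ₑ ∂μ ≤ ∫⁻ t, ((fun t => ‖w t‖ₑ) * fun t => ‖u t‖ₑ) t ∂μ :=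
          lintegral_mono fun t => (w t).le_opENorm (u t)
      _ ≤ _ := by
          refine (ENNReal.lintegral_mul_le_Lp_mul_Lq μ hpq.symm hw.1.enorm hu.1.enorm).trans ?_
          rw [eLpNorm_eq_lintegral_rpow_enorm_toReal (by simpa using hq0) ENNReal.ofReal_ne_top,
            eLpNorm_eq_lintegral_rpow_enorm_toReal (by simpa using hp0) ENNReal.ofReal_ne_top,
            ENNReal.toReal_ofReal hp0.le, ENNReal.toReal_ofReal hq0.le]
  refine ⟨⟨?_, hle.trans_lt (ENNReal.mul_lt_top hw.2 hu.2)⟩,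
    (enorm_integral_le_lintegral_enorm _).trans hle⟩
  exact isBoundedBilinearMap_apply.continuous.comp_aestronglyMeasurable (hw.1.prodMk hu.1)

end Reduction

/-! ### Assembly of the sequences -/

section Main

open scoped NNReal ENNReal

variable {T X : Type*} [MeasurableSpace T] {μ : Measure T} [NormedAddCommGroup X] [NormedSpace ℝ X]

/-- The data of the penalized problem associated with a Fréchet subgradient of an integral
functional. -/
theorem exists_penalization_data [IsFiniteMeasure μ] [MeasurableSpace X] [BorelSpace X]
    [SecondCountableTopology X] {p q : ℝ} (hpq : p.HolderConjugate q)
    {f : T → X → EReal} {g : T → X → ℝ} (hf : IsNormalIntegrand f)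
    (hg : IsNormalIntegrand fun t u => (g t u : EReal))
    (hgf : ∀ t u, (g t u : EReal) ≤ f t u) (hgC1 : ∀ t, ContDiff ℝ 1 (g t))
    (hgint : ∃ u, Integrable (fun t => g t u) μ)
    (hgrad : MemLp (fun t => ⨆ u : X, ‖fderiv ℝ (g t) u‖ₑ) (ENNReal.ofReal q) μ)
    {x : X} {x' : StrongDual ℝ X} (hx' : x' ∈ frechetSubdiff (integralFunctional μ f) x) :
    ∃ k c : T → ℝ, Measurable k ∧ Measurable c ∧ (∀ t, 0 ≤ k t) ∧ Integrable k μ ∧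
      (∀ᵐ t ∂μ, ∀ v y : X,
        0 ≤ f t (x + v) + ((‖v - y‖ ^ p + k t * ‖y‖ + c t : ℝ) : EReal)) ∧
      ∫⁻ t, penalizedIntegrand (fun t v => f t (x + v)) p k c t 0 0 ∂μ ≠ ⊤ ∧
      ∀ η > (0 : ℝ), ∃ r > 0, ∀ y, ‖y‖ ≤ r →
        ∫⁻ t, penalizedIntegrand (fun t v => f t (x + v)) p k c t y y ∂μ ≠ ⊤ →
        (∫⁻ t, penalizedIntegrand (fun t v => f t (x + v)) p k c t 0 0 ∂μ).toReal +
          (∫ t, k t ∂μ) * ‖y‖ + x' y ≤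
        (∫⁻ t, penalizedIntegrand (fun t v => f t (x + v)) p k c t y y ∂μ).toReal +
          η * ‖y‖ := by
  have hp0 := hpq.pos
  have hq0 := hpq.symm.pos
  have hq1 : 1 ≤ ENNReal.ofReal q := by
    simpa using ENNReal.ofReal_le_ofReal hpq.symm.lt.le
  obtain ⟨k, hk, hk0, hkq, hlip⟩ := exists_measurable_lipschitz_bound hpq.symm.lt hgC1 hgrad
  have hki : Integrable k μ := hkq.integrable hq1
  have hgm : ∀ u, Measurable fun t => g t u := fun u =>
    (hg.1.comp (measurable_id.prodMk measurable_const)).ereal_toReal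
  obtain ⟨u₀, hu₀⟩ := hgint
  have hgi : Integrable (fun t => g t x) μ := by
    refine (hu₀.norm.add (hki.mul_const ‖x - u₀‖)).mono' (hgm x).aestronglyMeasurable ?_
    filter_upwards [hlip] with t ht
    have := norm_add_le (g t x - g t u₀) (g t u₀)
    rw [sub_add_cancel, Real.norm_eq_abs (g t x - g t u₀)] at this
    simp only [Pi.add_apply]
    linarith [ht x u₀]
  have hkqi : Integrable (fun t => k t ^ q) μ := by
    have := hkq.integrable_norm_rpow (by simpa using hq0) ENNReal.ofReal_ne_top
    simpa [ENNReal.toReal_ofReal hq0.le, abs_of_nonneg, hk0] using this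
  -- `k^q` is the Young remainder and `g t x` the value of the minorant at the base point.
  let c : T → ℝ := fun t => k t ^ q - g t x
  have hc : Measurable c := (hk.pow_const q).sub (hgm x)
  have hci : Integrable c μ := hkqi.sub hgi
  have hgood : ∀ᵐ t ∂μ, ∀ v y : X,
      0 ≤ f t (x + v) + ((‖v - y‖ ^ p + k t * ‖y‖ + c t : ℝ) : EReal) := by
    filter_upwards [hlip] with t ht v y
    refine zero_le_add_coe_of_lipschitz hpq (hk0 t) (le_trans ?_ (hgf t (x + v)))
    have := (abs_le.1 (ht (x + v) x)).1
    rw [add_sub_cancel_left] at this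
    exact_mod_cast (by linarith : g t x - k t * ‖v‖ ≤ g t (x + v))
  have hfm : ∀ y, Measurable fun t => f t (x + y) := fun y =>
    hf.1.comp (measurable_id.prodMk measurable_const)
  -- On the diagonal the power vanishes, so `I_f(x + y)` is recovered up to explicit finite terms.
  have hJ : ∀ y, ∫⁻ t, (f t (x + y) + ((k t * ‖y‖ + c t : ℝ) : EReal)).toENNReal ∂μ =
      ∫⁻ t, penalizedIntegrand (fun t v => f t (x + v)) p k c t y y ∂μ := by
    intro y
    simp [penalizedIntegrand, hp0.ne']
  have hext := fun y => extIntegral_eq_of_nonneg_add (μ := μ) (hfm y)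
    (s := fun t => k t * ‖y‖ + c t) ((hki.mul_const _).add hci) (by
      filter_upwards [hgood] with t ht
      simpa [hp0.ne'] using ht y y)
  have hsint : ∀ y : X, ∫ t, (k t * ‖y‖ + c t) ∂μ = (∫ t, k t ∂μ) * ‖y‖ + ∫ t, c t ∂μ := by
    intro y
    rw [integral_add (hki.mul_const _) hci, integral_mul_const]
  simp only [hJ, hsint] at hext
  obtain ⟨-, htop, hsub⟩ := mem_frechetSubdiff_iff.1 hx'
  have hfin : ∫⁻ t, penalizedIntegrand (fun t v => f t (x + v)) p k c t 0 0 ∂μ ≠ ⊤ := by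
    intro h
    refine htop ?_
    have := (hext 0).1 h
    simpa [integralFunctional] using this
  have hx0 : (integralFunctional μ f x).toReal =
      (∫⁻ t, penalizedIntegrand (fun t v => f t (x + v)) p k c t 0 0 ∂μ).toReal -
        ∫ t, c t ∂μ := by
    have := (hext 0).2 hfin
    simp only [add_zero, norm_zero, mul_zero, zero_add] at this
    rw [integralFunctional, this, EReal.toReal_coe]
  refine ⟨k, c, hk, hc, hk0, hki, hgood, hfin, fun η hη => ?_⟩
  obtain ⟨r, hr, hball⟩ := Metric.eventually_nhds_iff.1 (hsub η hη)
  refine ⟨r / 2, by positivity, fun y hy hyt => ?_⟩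
  have h1 := hball (show dist y 0 < r by rw [dist_zero_right]; linarith)
  rw [hx0, integralFunctional, (hext y).2 hyt, EReal.coe_le_coe_iff] at h1
  linarith

/-- Approximate subgradients of an integral functional along finitely many directions. -/
theorem exists_approximate_subgradient_le [IsFiniteMeasure μ] [CompleteSpace X]
    [MeasurableSpace X] [BorelSpace X] [SecondCountableTopology X]
    (hnorm : ContDiffOn ℝ 1 (fun u : X => ‖u‖) {0}ᶜ) {p q : ℝ} (hpq : p.HolderConjugate q)
    {f : T → X → EReal} (hf : Measurable (Function.uncurry f))
    (hlsc : ∀ t, LowerSemicontinuous (f t)) {k c : T → ℝ} (hk : Measurable k) (hc : Measurable c)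
    (hk0 : ∀ t, 0 ≤ k t) (hki : Integrable k μ)
    (hgood : ∀ᵐ t ∂μ, ∀ v y : X,
      0 ≤ f t v + ((‖v - y‖ ^ p + k t * ‖y‖ + c t : ℝ) : EReal))
    (hfin : ∫⁻ t, penalizedIntegrand f p k c t 0 0 ∂μ ≠ ⊤) {x' : StrongDual ℝ X}
    (hgrow : ∀ η > (0 : ℝ), ∃ r > 0, ∀ y, ‖y‖ ≤ r →
      ∫⁻ t, penalizedIntegrand f p k c t y y ∂μ ≠ ⊤ →
      (∫⁻ t, penalizedIntegrand f p k c t 0 0 ∂μ).toReal + (∫ t, k t ∂μ) * ‖y‖ + x' y ≤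
        (∫⁻ t, penalizedIntegrand f p k c t y y ∂μ).toReal + η * ‖y‖)
    (s : Finset X) {ε : ℝ} (hε : 0 < ε) :
    ∃ (y : X) (v : T → X) (w : T → StrongDual ℝ X),
      MemLp v (ENNReal.ofReal p) μ ∧ MemLp w (ENNReal.ofReal q) μ ∧
      (∀ᵐ t ∂μ, w t ∈ frechetSubdiff (f t) (v t)) ∧ ‖y‖ ≤ ε ∧
      eLpNorm v (ENNReal.ofReal p) μ ≤ ENNReal.ofReal ε ∧
      eLpNorm w (ENNReal.ofReal q) μ * eLpNorm (fun t => v t - y) (ENNReal.ofReal p) μ ≤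
        ENNReal.ofReal ε ∧
      |∫ t, w t (v t) ∂μ| ≤ ε + (‖x'‖ + ε) * ε ∧
      (∀ u ∈ s, |(∫ t, w t ∂μ) u - x' u| ≤ ε * ‖u‖) ∧
      ∫⁻ t, (f t (v t) - f t 0).abs ∂μ ≤ ENNReal.ofReal ε := by
  have hp0 := hpq.pos
  have hq0 := hpq.symm.pos
  have hp1 : 1 ≤ ENNReal.ofReal p := by simpa using ENNReal.ofReal_le_ofReal hpq.lt.le
  have hq1 : 1 ≤ ENNReal.ofReal q := by simpa using ENNReal.ofReal_le_ofReal hpq.symm.lt.le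
  -- One half of `ε` is reserved for the integrated perturbation; the other is the `η` of
  -- `exists_approximate_subgradient`, whose growth condition carries `η / 2`.
  obtain ⟨r, hr, hgr⟩ := hgrow (ε / 2 / 2) (by positivity)
  let L : Submodule ℝ X := Submodule.span ℝ (s : Set X)
  have hLfin : FiniteDimensional ℝ L := FiniteDimensional.span_finset ℝ s
  have hε' : 0 < ENNReal.ofReal ε := ENNReal.ofReal_pos.2 hε
  have hε2 : 0 < ENNReal.ofReal (ε / 2) := ENNReal.ofReal_pos.2 (half_pos hε)
  have hr' : 0 < ENNReal.ofReal r := ENNReal.ofReal_pos.2 hr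
  have hid : Tendsto (fun τ : ℝ≥0∞ => τ) (𝓝[>] 0) (𝓝 0) := nhdsWithin_le_nhds
  have hpow : ∀ {a : ℝ}, 0 < a → Tendsto (fun τ : ℝ≥0∞ => τ ^ (1 / a)) (𝓝[>] 0) (𝓝 0) := by
    intro a ha
    simpa [ENNReal.zero_rpow_of_pos (inv_pos.2 ha)] using hid.ennrpow_const (1 / a)
  have hcm : ∀ {b : ℝ≥0∞} {F : ℝ≥0∞ → ℝ≥0∞}, b ≠ ⊤ → Tendsto F (𝓝[>] 0) (𝓝 0) →
      Tendsto (fun τ => b * F τ) (𝓝[>] 0) (𝓝 0) := fun hb hF => by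
    simpa using ENNReal.Tendsto.const_mul hF (.inr hb)
  have hmt : ∀ {a : ℝ}, 0 ≤ a → μ univ ^ a ≠ ⊤ := fun ha =>
    ENNReal.rpow_ne_top_of_nonneg ha (measure_ne_top _ _)
  have hq01 : 0 ≤ 1 - 1 / q := by
    rw [sub_nonneg, div_le_one hq0]
    exact hpq.symm.lt.le
  have t1 : Tendsto (fun τ : ℝ≥0∞ => τ ^ (1 / p) + μ univ ^ (1 / p) * τ) (𝓝[>] 0) (𝓝 0) := by
    simpa using (hpow hp0).add (hcm (hmt (a := 1 / p) (by positivity)) hid)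
  have t2 : Tendsto (fun τ : ℝ≥0∞ => 2 * ENNReal.ofReal p * τ) (𝓝[>] 0) (𝓝 0) :=
    hcm (by simp [ENNReal.mul_eq_top]) hid
  have t3 : Tendsto (fun τ : ℝ≥0∞ => ENNReal.ofReal p * τ ^ (1 / q) * μ univ ^ (1 - 1 / q))
      (𝓝[>] 0) (𝓝 0) := by
    have := hcm (hmt hq01) (hcm (b := ENNReal.ofReal p) ENNReal.ofReal_ne_top (hpow hq0))
    simpa only [mul_comm] using this
  have t4 : Tendsto (fun τ : ℝ≥0∞ => 2 * τ + ENNReal.ofReal (∫ t, k t ∂μ) * τ)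
      (𝓝[>] 0) (𝓝 0) := by
    simpa using (hcm (b := 2) (by simp) hid).add
      (hcm (b := ENNReal.ofReal (∫ t, k t ∂μ)) ENNReal.ofReal_ne_top hid)
  have hpos : ∀ᶠ τ in 𝓝[>] (0 : ℝ≥0∞), 0 < τ := self_mem_nhdsWithin
  obtain ⟨τ, hτ, hτr, hτε, b1, b2, b3, b4⟩ := (hpos.and
    ((hid.eventually (gt_mem_nhds hr')).and ((hid.eventually (ge_mem_nhds hε')).and
    ((t1.eventually (ge_mem_nhds hε')).and ((t2.eventually (ge_mem_nhds hε')).and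
    ((t3.eventually (ge_mem_nhds hε2)).and (t4.eventually (ge_mem_nhds hε')))))))).exists
  obtain ⟨y, v, w, hyL, hv, hvp, hwq, hsub, hyτ, hvy, hprod, hLu, habs⟩ :=
    exists_approximate_subgradient hnorm hpq hf hlsc hk hc hk0 hki hgood hfin (half_pos hε) hr hgr L
      hτ hτr
  have hyε : ‖y‖ ≤ ε := by
    rw [← ENNReal.ofReal_le_ofReal_iff hε.le, ofReal_norm]
    exact hyτ.trans hτε
  have hLu' : ∀ u ∈ L, |(∫ t, w t ∂μ) u - x' u| ≤ ε * ‖u‖ := by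
    intro u hu
    refine (hLu u hu).trans (mul_le_mul_of_nonneg_right ?_ (norm_nonneg u))
    have := ENNReal.toReal_mono ENNReal.ofReal_ne_top b3
    rw [ENNReal.toReal_ofReal (half_pos hε).le] at this
    linarith
  refine ⟨y, v, w, hvp, hwq, hsub, hyε, ?_, hprod.trans b2, ?_,
    fun u hu => hLu' u (Submodule.subset_span hu), habs.trans b4⟩
  · refine le_trans ?_ b1
    have h1 : v = (fun t => v t - y) + fun _ => y := by
      ext t
      simp
    have h2 := eLpNorm_add_le (hvp.sub (memLp_const y)).1
      (aestronglyMeasurable_const (b := y) (μ := μ)) hp1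
    calc eLpNorm v (ENNReal.ofReal p) μ
        ≤ eLpNorm (fun t => v t - y) (ENNReal.ofReal p) μ +
          eLpNorm (fun _ => y) (ENNReal.ofReal p) μ := by
          conv_lhs => rw [h1]
          exact h2
      _ ≤ τ ^ (1 / p) + μ univ ^ (1 / p) * τ := by
          refine add_le_add hvy ?_
          rw [eLpNorm_const' _ (by simpa using hp0) ENNReal.ofReal_ne_top,
            ENNReal.toReal_ofReal hp0.le, mul_comm]
          gcongr
  · obtain ⟨hi, hle⟩ := enorm_integral_apply_le (u := fun t => v t - y) hpq hwq
      (hvp.sub (memLp_const y))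
    have hwi : Integrable w μ := hwq.integrable hq1
    -- The first part is controlled by the product estimate. The second is controlled because `y ∈
    -- L`, where `∫ w` is close to `x'`.
    have h1 : ∫ t, w t (v t) ∂μ = ∫ t, w t (v t - y) ∂μ + (∫ t, w t ∂μ) y := by
      rw [ContinuousLinearMap.integral_apply hwi, ← integral_add hi (hwi.apply_continuousLinearMap y)]
      refine integral_congr_ae (ae_of_all _ fun t => ?_)
      simp
    have h2 : |∫ t, w t (v t - y) ∂μ| ≤ ε := by
      rw [← ENNReal.ofReal_le_ofReal_iff hε.le, ← Real.norm_eq_abs, ofReal_norm]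
      exact hle.trans (hprod.trans b2)
    have h3 : |(∫ t, w t ∂μ) y| ≤ (‖x'‖ + ε) * ε := by
      have h4 : |(∫ t, w t ∂μ) y| ≤ |(∫ t, w t ∂μ) y - x' y| + |x' y| := by
        simpa using abs_add_le ((∫ t, w t ∂μ) y - x' y) (x' y)
      have h5 : |x' y| ≤ ‖x'‖ * ‖y‖ := x'.le_opNorm y
      have h6 := hLu' y hyL
      have h7 : (‖x'‖ + ε) * ‖y‖ ≤ (‖x'‖ + ε) * ε := by gcongr
      linarith
    rw [h1]
    exact (abs_add_le _ _).trans (add_le_add h2 h3)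

end Main

theorem mainTheorem1
    {T : Type*} [MeasurableSpace T] (μ : Measure T) [IsFiniteMeasure μ] [μ.IsComplete]
    {X : Type*} [NormedAddCommGroup X] [NormedSpace ℝ X] [CompleteSpace X]
    [TopologicalSpace.SeparableSpace X] [MeasurableSpace X] [BorelSpace X]
    (hX : IsAsplund X)
    (hnorm : ContDiffOn ℝ 1 (fun u : X => ‖u‖) {0}ᶜ)
    (p q : ℝ) (hp : 1 < p) (hq : 1 < q) (hpq : 1 / p + 1 / q = 1)
    (f : T → X → EReal) (g : T → X → ℝ)
    (hf : IsNormalIntegrand f)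
    (hg : IsNormalIntegrand fun t u => (g t u : EReal))
    (hgf : ∀ t u, (g t u : EReal) ≤ f t u)
    (hgC1 : ∀ t, ContDiff ℝ 1 (g t))
    (hgint : ∃ u, Integrable (fun t => g t u) μ)
    (hgrad : MemLp (fun t => ⨆ u : X, ‖fderiv ℝ (g t) u‖ₑ) (ENNReal.ofReal q) μ)
    (x : X) (x' : StrongDual ℝ X) (hx' : x' ∈ frechetSubdiff (integralFunctional μ f) x)
    (ρ : Seminorm ℝ (WeakDual ℝ X)) (hρ : Continuous ρ) :
    ∃ (yₙ : ℕ → X) (xₙ : ℕ → T → X) (xₙ' : ℕ → T → StrongDual ℝ X),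
      (∀ n, MemLp (xₙ n) (ENNReal.ofReal p) μ) ∧
      (∀ n, MemLp (xₙ' n) (ENNReal.ofReal q) μ) ∧
      (∀ n, ∀ᵐ t ∂μ, xₙ' n t ∈ frechetSubdiff (f t) (xₙ n t)) ∧
      Tendsto yₙ atTop (𝓝 x) ∧
      Tendsto (fun n => eLpNorm (fun t => xₙ n t - x) (ENNReal.ofReal p) μ) atTop (𝓝 0) ∧
      Tendsto (fun n => eLpNorm (xₙ' n) (ENNReal.ofReal q) μ *
        eLpNorm (fun t => xₙ n t - yₙ n) (ENNReal.ofReal p) μ) atTop (𝓝 0) ∧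
      Tendsto (fun n => ∫ t, xₙ' n t (xₙ n t - x) ∂μ) atTop (𝓝 0) ∧
      Tendsto (fun n => ρ (StrongDual.toWeakDual ((∫ t, xₙ' n t ∂μ) - x'))) atTop (𝓝 0) ∧
      Tendsto (fun n => ∫⁻ t, (f t (xₙ n t) - f t x).abs ∂μ) atTop (𝓝 0) := by
  have hpq' : p.HolderConjugate q := by
    rw [Real.holderConjugate_iff]
    exact ⟨hp, by simpa using hpq⟩
  have : SecondCountableTopology X := UniformSpace.secondCountable_of_separable X
  obtain ⟨k, c, hk, hc, hk0, hki, hgood, hfin, hgrow⟩ :=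
    exists_penalization_data hpq' hf hg hgf hgC1 hgint hgrad hx'
  obtain ⟨s, C, hC, hCs⟩ := ρ.exists_finset_bound_of_continuous_weakDual hρ
  have hfm : Measurable (Function.uncurry fun t v => f t (x + v)) :=
    hf.1.comp (measurable_fst.prodMk (measurable_snd.const_add x))
  let ε : ℕ → ℝ := fun n => 1 / ((n : ℝ) + 1)
  have hε : ∀ n, 0 < ε n := fun n => Nat.one_div_pos_of_nat
  have hε0 : Tendsto ε atTop (𝓝 0) := tendsto_one_div_add_atTop_nhds_zero_nat
  have hεe : Tendsto (fun n => ENNReal.ofReal (ε n)) atTop (𝓝 0) := by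
    simpa using ENNReal.tendsto_ofReal hε0
  choose y v w hv hw hsub hy hvε hprod hpair hs habs using fun n =>
    exists_approximate_subgradient_le hnorm hpq' hfm
      (fun t => (hf.2 t).comp (continuous_const.add continuous_id)) hk hc hk0 hki hgood hfin hgrow s
      (hε n)
  have sq : ∀ {F : ℕ → ENNReal}, (∀ n, F n ≤ ENNReal.ofReal (ε n)) → Tendsto F atTop (𝓝 0) :=
    fun hF => tendsto_of_tendsto_of_tendsto_of_le_of_le tendsto_const_nhds hεe
      (fun _ => zero_le) hF
  refine ⟨fun n => x + y n, fun n t => x + v n t, w, fun n => (memLp_const x).add (hv n), hw,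
    fun n => ?_, ?_, sq fun n => ?_, sq fun n => ?_, ?_, ?_, sq fun n => ?_⟩
  · filter_upwards [hsub n] with t ht
    exact mem_frechetSubdiff_comp_const_add.1 ht
  · have hy0 : Tendsto y atTop (𝓝 0) := squeeze_zero_norm hy hε0
    simpa using hy0.const_add x
  · simpa using hvε n
  · simpa using hprod n
  · refine squeeze_zero_norm (a := fun n => ε n + (‖x'‖ + ε n) * ε n) (fun n => ?_) ?_
    · simpa using hpair n
    · simpa using hε0.add ((hε0.const_add ‖x'‖).mul hε0)
  · have hlim : Tendsto (fun n => C * (ε n * ∑ u ∈ s, ‖u‖)) atTop (𝓝 0) := by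
      simpa using (hε0.mul_const (∑ u ∈ s, ‖u‖)).const_mul C
    refine squeeze_zero (fun n => apply_nonneg ρ _) (fun n => ?_) hlim
    have h0 : 0 ≤ ∑ u ∈ s, ‖u‖ := Finset.sum_nonneg fun u _ => norm_nonneg u
    refine hCs _ _ (mul_nonneg (hε n).le h0) fun u hu => ?_
    refine (hs n u hu).trans (mul_le_mul_of_nonneg_left ?_ (hε n).le)
    exact Finset.single_le_sum (f := fun u => ‖u‖) (fun u _ => norm_nonneg u) hu
  · simpa using habs n
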